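/- Consider discrete-time load balancing systems with $N$ servers, indexed by $\epsilon\in(0,\mu_\Sigma)$. In each time-slot $t$, $A_\Sigma^{(\epsilon)}(t)$ tasks arrive, all of them are sent to one server, and $Q_n(t+1)=Q_n(t)+A_n(t)-S_n(t)+U_n(t)$ with $U_n(t)=\max\{S_n(t)-Q_n(t)-A_n(t),0\}$, where $A_n(t)$ is the number of tasks sent to server $n$ and $S_n(t)$ the service it offers. The arrivals $A_\Sigma^{(\epsilon)}(t)$ and services $S_n(t)$ are nonnegative integers, i.i.d. over time-slots and mutually independent, bounded by constants $A_{\max}$, $S_{\max}$ that do not depend on $\epsilon$, with $\mathbb P(A_\Sigma^{(\epsilon)}(t)=0)>0$. The law of $S_n(t)$ does not depend on $\epsilon$; it has mean $\mu_n$ and variance $\nu_n^2$; put $\mu_\Sigma=\sum_n\mu_n>0$ and $\nu_\Sigma^2=\sum_n\nu_n^2$. The arrivals have mean $\mu_\Sigma-\epsilon$, and their variance converges to a constant $\sigma_\Sigma^2$ as $\epsilon\downarrow0$. Let $\zeta=\sigma_\Sigma^2+\nu_\Sigma^2$. The dispatching policy (which may depend on $\epsilon$) is Markovian: given the current state $\mathbf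 Q(t)$, let $\sigma_t(n)$ be the server with the $n$th shortest queue, ties being broken at random, and let $P_n(t)$ be the probability that the new tasks are sent to $\sigma_t(n)$. Let $\Delta_n(t)=P_n(t)-\mu_{\sigma_t(n)}/\mu_\Sigma$. The policy is throughput optimal if for every $\epsilon$ the chain $\mathbf Q^{(\epsilon)}$ is positive recurrent and all moments of the norm of its steady-state vector $\overline{\mathbf Q}^{(\epsilon)}$ are finite. It is heavy-traffic delay optimal if $\limsup_{\epsilon\downarrow0}\epsilon\,\mathbb E\big[\sum_n\overline Q_n^{(\epsilon)}\big]\le\zeta/2$. For $\alpha\in[0,1]$ let $\mathcal K_\alpha=\{\sum_n w_n\mathbf b^{(n)}: w_n\ge0\}$, where $\mathbf b^{(n)}\in\mathbb R^N$ has $n$th component $1$ and all other components $\alpha$. **Proposition.** Suppose that a throughput optimal policy, numbers $\alpha^{(\epsilon)}\in[0,1]$ and real numbers $\delta^{(\epsilon)}$ are such that, for every $\epsilon$ and whenever $\mathbf Q^{(\epsilon)}(t)\notin\mathcal K_{\alpha^{(\epsilon)}}$, there is some $k\in\{2,\dots,N\}$ with $$\Delta_n(t)\ge0\ \text{ for }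 n<k,\qquad \Delta_n(t)\le0\ \text{ for } n\ge k,$$ and $$\min\big(|\Delta_1(t)|,|\Delta_N(t)|\big)\ge\delta^{(\epsilon)}.$$ If $\alpha^{(\epsilon)}\delta^{(\epsilon)}=\Omega(\epsilon^\beta)$ as $\epsilon\downarrow0$ for some $\beta\in[0,1)$, that is, $\alpha^{(\epsilon)}\delta^{(\epsilon)}\ge c\,\epsilon^\beta$ for some $c>0$ and all small $\epsilon>0$, then the policy is heavy-traffic delay optimal. -/

import Mathlib

open MeasureTheory ProbabilityTheory Filter Topology Set
open scoped ENNReal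

noncomputable section

namespace LoadBalancing

/-- Mean of a law on the nonnegative integers. -/
def mean (p : PMF ℕ) : ℝ := ∫ k, (k : ℝ) ∂p.toMeasure

/-- Variance of a law on the nonnegative integers. -/
def var (p : PMF ℕ) : ℝ := Var[fun k : ℕ => (k : ℝ); p.toMeasure]

/-- The primitives of a family of discrete-time systems with `N` servers, indexed by the
heavy-traffic parameter `ε`. In each time-slot the number of exogenous arrivals has law `arr ε`
and the service offered by server `n` has law `svc n`. Only the parameters `ε` strictly between
`0` and the total service rate are meaningful (arrival rate strictly inside the capacity region). -/
structure Model (N : ℕ) where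
  arr : ℝ → PMF ℕ
  svc : Fin N → PMF ℕ
  Amax : ℕ
  Smax : ℕ
  totalRate_pos : 0 < ∑ n, mean (svc n)
  mean_arr : ∀ ε ∈ Ioo 0 (∑ n, mean (svc n)), mean (arr ε) = (∑ n, mean (svc n)) - ε
  arr_zero : ∀ ε ∈ Ioo 0 (∑ n, mean (svc n)), arr ε 0 ≠ 0
  arr_le : ∀ ε ∈ Ioo 0 (∑ n, mean (svc n)), ∀ k ∈ (arr ε).support, k ≤ Amax
  svc_le : ∀ n, ∀ k ∈ (svc n).support, k ≤ Smax

variable {N : ℕ}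

/-- Service rate `μ_n` of server `n`. -/
def Model.rate (M : Model N) (n : Fin N) : ℝ := mean (M.svc n)

/-- Total service rate `μ_Σ`. -/
def Model.totalRate (M : Model N) : ℝ := ∑ n, M.rate n

/-- Total service variance `ν_Σ²`. -/
def Model.totalSvcVar (M : Model N) : ℝ := ∑ n, var (M.svc n)

/-- A Markovian load balancing policy. In state `q` the servers are first listed from the
shortest to the longest queue: `σ n` is the server with the `n`-th shortest queue (indices start
at `0`), where ties are broken at random according to `tie q`. The new tasks are then sent
to the `n`-th shortest queue with probability `rank q σ n`. -/
structure Policy (N : ℕ) where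
  tie : (Fin N → ℕ) → PMF (Equiv.Perm (Fin N))
  tie_sorted : ∀ q, ∀ σ ∈ (tie q).support, Monotone (q ∘ σ)
  rank : (Fin N → ℕ) → Equiv.Perm (Fin N) → PMF (Fin N)

/-- Law of the server to which the new tasks are sent in state `q`. -/
def Policy.dispatch (P : Policy N) (q : Fin N → ℕ) : PMF (Fin N) :=
  (P.tie q).bind fun σ => (P.rank q σ).map σ

/-- Number of tasks routed to queue `j` when `a` tasks arrive and are sent to server `i`. -/
def routed (a : ℕ) (i j : Fin N) : ℕ := if j = i then a else 0

/-- Unused service `max (S_j - Q_j - A_j) 0` (truncated subtraction). -/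
def unused (q : Fin N → ℕ) (a : ℕ) (s : Fin N → ℕ) (i j : Fin N) : ℕ :=
  s j - (q j + routed a i j)

/-- The queue lengths in the next time-slot, `Q_j + A_j - S_j + U_j`. -/
def next (q : Fin N → ℕ) (a : ℕ) (s : Fin N → ℕ) (i j : Fin N) : ℕ :=
  q j + routed a i j + unused q a s i j - s j

/-- The subtraction in `next` is never truncated. -/
theorem next_cast (q : Fin N → ℕ) (a : ℕ) (s : Fin N → ℕ) (i j : Fin N) :
    (next q a s i j : ℤ) = q j + routed a i j - s j + unused q a s i j := by
  unfold next unused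
  omega

/-- One-step transition kernel of the queue length chain at parameter `ε`: arrivals, the services
of the different servers and, given the current state, the dispatching decision are
independent. -/
def transition (M : Model N) (P : ℝ → Policy N) (ε : ℝ) :
    Kernel (Fin N → ℕ) (Fin N → ℕ) :=
  Kernel.ofFunOfCountable fun q =>
    ((M.arr ε).toMeasure.prod
      ((Measure.pi fun n => (M.svc n).toMeasure).prod ((P ε).dispatch q).toMeasure)).map
      fun z => next q z.1 z.2.1 z.2.2

/-- For a Markov chain `X` with kernel `κ` and `T = min {t ≥ 1 | X t = z}`, the probability
that `T > t` when the chain starts in `x`. -/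
def noVisit {E : Type*} [MeasurableSpace E] (κ : Kernel E E) (z : E) : ℕ → E → ℝ≥0∞
  | 0, _ => 1
  | t + 1, x => ∫⁻ y in {z}ᶜ, noVisit κ z t y ∂(κ x)

/-- Mean return time `E_z[T]` of the state `z`, as the sum of the tails `P_z(T > t)`. -/
def meanReturnTime {E : Type*} [MeasurableSpace E] (κ : Kernel E E) (z : E) : ℝ≥0∞ :=
  ∑' t, noVisit κ z t z

/-- Stability: the queue length chain is positive recurrent, that is, every state which can be
reached from the empty system has a finite mean return time. -/
def Stable (κ : Kernel (Fin N → ℕ) (Fin N → ℕ)) : Prop :=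
  ∀ q, Relation.ReflTransGen (fun x y => κ x {y} ≠ 0) 0 q → meanReturnTime κ q < ∞

/-- `π` is a steady-state distribution of the chain. -/
def IsSteadyState (κ : Kernel (Fin N → ℕ) (Fin N → ℕ)) (π : Measure (Fin N → ℕ)) : Prop :=
  IsProbabilityMeasure π ∧ κ.Invariant π

/-- The queue length vector as a point of Euclidean space. -/
def vec (q : Fin N → ℕ) : EuclideanSpace ℝ (Fin N) := WithLp.toLp 2 fun n => (q n : ℝ)

/-- Throughput optimality: for every arrival rate inside the capacity region the system is stable
and all moments of the Euclidean norm of the steady-state queue length vector are finite. -/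
def ThroughputOptimal (M : Model N) (P : ℝ → Policy N) : Prop :=
  ∀ ε ∈ Ioo 0 M.totalRate,
    Stable (transition M P ε) ∧
      ∀ π, IsSteadyState (transition M P ε) π → ∀ r : ℕ, ∫⁻ q, ‖vec q‖ₑ ^ r ∂π < ∞

/-- Heavy-traffic delay optimality in steady-state, when the variances of the arrival laws converge
to `σ2`: the upper limit, as `ε ↓ 0`, of `ε` times the mean total queue length in steady-state
is at most `ζ / 2`, where `ζ = σ2 + ν_Σ²`. -/
def HeavyTrafficDelayOptimal (M : Model N) (P : ℝ → Policy N) (σ2 : ℝ) : Prop :=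
  ∀ π : ℝ → Measure (Fin N → ℕ),
    (∀ ε ∈ Ioo 0 M.totalRate, IsSteadyState (transition M P ε) (π ε)) →
      limsup (fun ε => ENNReal.ofReal ε * ∫⁻ q, (∑ n, (q n : ℝ≥0∞)) ∂(π ε)) (𝓝[>] 0)
        ≤ ENNReal.ofReal ((σ2 + M.totalSvcVar) / 2)

/-- The generator `b^(n)`: entry `1` in position `n` and `α` elsewhere. -/
def generator (α : ℝ) (n : Fin N) : EuclideanSpace ℝ (Fin N) :=
  WithLp.toLp 2 fun j => if j = n then 1 else α

/-- The cone `K_α` generated by the vectors `b^(n)`. -/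
def cone (N : ℕ) (α : ℝ) : Set (EuclideanSpace ℝ (Fin N)) :=
  {x | ∃ w : Fin N → ℝ, (∀ n, 0 ≤ w n) ∧ x = ∑ n, w n • generator α n}

/-- `Δ_n`: the probability of dispatching to the `n`-th shortest queue minus the same probability
under random routing proportional to the service rates. -/
def Delta (M : Model N) (P : Policy N) (q : Fin N → ℕ) (σ : Equiv.Perm (Fin N)) (n : Fin N) : ℝ :=
  (P.rank q σ n).toReal - M.rate (σ n) / M.totalRate

/-- In every state outside `K_α` (and for every possible outcome of the tie-breaking) the vector `Δ`
changes sign once, from nonnegative to nonpositive, and its first and last entries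
have absolute value at least `δ`. -/
def FavoursShorter [NeZero N] (M : Model N) (P : Policy N) (α δ : ℝ) : Prop :=
  ∀ q, vec q ∉ cone N α → ∀ σ ∈ (P.tie q).support,
    (∃ k : Fin N, 0 < k ∧ (∀ n < k, 0 ≤ Delta M P q σ n) ∧ (∀ n ≥ k, Delta M P q σ n ≤ 0)) ∧
      δ ≤ min |Delta M P q σ 0| |Delta M P q σ (Fin.rev 0)|

end LoadBalancing

end

/-! Put `γ = α / (1 + (N - 1) α)`. Every entry of a vector in `K_α` is at least the fraction `γ` of
its total, so the deficits `(γ * tot q - q n)⁺` vanish on the cone, and their norm is an explicit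
substitute for the distance to it. Let `V = sqDeficit γ` be its square.

Collapse: up to a bounded error, the increment of `V` is linear in arrivals minus services. Outside
the cone, testing the single sign change of `Δ` against the deficits sorted by queue length gives a
mean drift of at most `-const * δ * √V` (`integral_linDrift_le`). The drift of `V ^ (m + 1)`
vanishes in steady state, whence `E[V ^ m * √V] ≤ C / δ ^ (2 m + 1)` with `C` independent of `ε` and
of the policy (`exists_moment_bound`).

Delay: the drift of the squared total also vanishes in steady state. This bounds `ε * E[tot]` by
half of the variance of the net input, plus `ε ^ 2 / 2`, plus the mean of the cross term (next
total) × (unused service) (`two_mul_integral_tot_le`). A server that wastes service ends the slot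
empty, so its deficit is then `γ` times the next total; hence `γ` times the cross term is at most
`√V` in the next state times the unused service. The latter is bounded and has mean `ε`, so
splitting at `√V = s / δ` bounds the mean cross term by a multiple of `(s * ε + s ^ (-2 m)) / (α *
δ)` (`exists_tot_bound`). As `α * δ ≥ c * ε ^ β` with `β < 1`, this tends to `0` when `s` is a
suitable negative power of `ε` and `m` is large. -/

namespace LoadBalancing

/-! ### Pathwise estimates -/

/-- Total queue length. -/
def tot {N : ℕ} (q : Fin N → ℕ) : ℝ := ∑ n, (q n : ℝ)

/-- The amount by which queue `n` falls short of the fraction `γ` of the total queue length. -/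
def deficit {N : ℕ} (γ : ℝ) (q : Fin N → ℕ) (n : Fin N) : ℝ := max (γ * tot q - q n) 0

/-- The squared Euclidean norm of the vector of deficits. -/
def sqDeficit {N : ℕ} (γ : ℝ) (q : Fin N → ℕ) : ℝ := ∑ n, deficit γ q n ^ 2

/-- The linear part of the one-step increment of `sqDeficit`. -/
def linDrift {N : ℕ} (γ : ℝ) (q : Fin N → ℕ) (a : ℕ) (s : Fin N → ℕ) (i : Fin N) : ℝ :=
  ∑ j, (γ * ∑ n, deficit γ q n - deficit γ q j) * ((routed a i j : ℝ) - s j)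

variable {N : ℕ}

theorem tot_nonneg (q : Fin N → ℕ) : 0 ≤ tot q := Finset.sum_nonneg fun _ _ => by positivity

theorem deficit_nonneg (γ : ℝ) (q : Fin N → ℕ) (n : Fin N) : 0 ≤ deficit γ q n := le_max_right _ _

theorem sqDeficit_nonneg (γ : ℝ) (q : Fin N → ℕ) : 0 ≤ sqDeficit γ q :=
  Finset.sum_nonneg fun _ _ => by positivity

theorem deficit_le_sqrt (γ : ℝ) (q : Fin N → ℕ) (n : Fin N) :
    deficit γ q n ≤ √(sqDeficit γ q) := by
  apply Real.le_sqrt_of_sq_le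
  exact Finset.single_le_sum (f := fun n => deficit γ q n ^ 2) (fun _ _ => by positivity)
    (Finset.mem_univ n)

theorem deficit_le {γ : ℝ} (hγ : 0 ≤ γ) (q : Fin N → ℕ) (n : Fin N) :
    deficit γ q n ≤ γ * tot q := by
  apply max_le
  · linarith [(q n).cast_nonneg (α := ℝ)]
  · exact mul_nonneg hγ (tot_nonneg q)

theorem next_cast_real (q : Fin N → ℕ) (a : ℕ) (s : Fin N → ℕ) (i j : Fin N) :
    (next q a s i j : ℝ) = q j + routed a i j - s j + unused q a s i j := by
  exact_mod_cast next_cast q a s i j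

theorem unused_le (q : Fin N → ℕ) (a : ℕ) (s : Fin N → ℕ) (i j : Fin N) :
    unused q a s i j ≤ s j := Nat.sub_le _ _

theorem next_eq_zero_of_unused {q : Fin N → ℕ} {a : ℕ} {s : Fin N → ℕ} {i j : Fin N}
    (h : unused q a s i j ≠ 0) : next q a s i j = 0 := by
  unfold next unused at *
  omega

theorem le_of_unused {q : Fin N → ℕ} {a : ℕ} {s : Fin N → ℕ} {i j : Fin N}
    (h : unused q a s i j ≠ 0) : q j ≤ s j := by
  unfold unused at *
  omega

theorem routed_le (a : ℕ) (i j : Fin N) : routed a i j ≤ a := by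
  unfold routed; split_ifs <;> omega

theorem sum_routed (a : ℕ) (i : Fin N) : ∑ j, (routed a i j : ℝ) = a := by
  simp [routed]

theorem abs_next_sub_le {q : Fin N → ℕ} {a : ℕ} {s : Fin N → ℕ} {A S : ℕ} (ha : a ≤ A)
    (hs : ∀ n, s n ≤ S) (i j : Fin N) : |(next q a s i j : ℝ) - q j| ≤ A + S := by
  have h1 := routed_le a i j
  have h2 := hs j
  have h3 : (next q a s i j : ℤ) - q j ≤ A + S := by
    unfold next unused; omega
  have h4 : -(A + S : ℤ) ≤ (next q a s i j : ℤ) - q j := by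
    unfold next unused; omega
  rw [abs_le]
  exact ⟨by exact_mod_cast h4, by exact_mod_cast h3⟩

theorem tot_next (q : Fin N → ℕ) (a : ℕ) (s : Fin N → ℕ) (i : Fin N) :
    tot (next q a s i) = tot q + (a - ∑ j, (s j : ℝ)) + ∑ j, (unused q a s i j : ℝ) := by
  unfold tot
  simp_rw [next_cast_real]
  rw [Finset.sum_add_distrib, Finset.sum_sub_distrib, Finset.sum_add_distrib, sum_routed]
  ring

/-- Unused service forces an empty queue, so that the whole total queue length shows up in the
deficit. -/
theorem tot_next_mul_unused_le {γ : ℝ} (q : Fin N → ℕ) (a : ℕ) (s : Fin N → ℕ) (i : Fin N) :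
    γ * (tot (next q a s i) * ∑ j, (unused q a s i j : ℝ)) ≤
      √(sqDeficit γ (next q a s i)) * ∑ j, (unused q a s i j : ℝ) := by
  rw [← mul_assoc, Finset.mul_sum, Finset.mul_sum]
  refine Finset.sum_le_sum fun j _ => ?_
  by_cases h : unused q a s i j = 0
  · simp [h]
  · refine mul_le_mul_of_nonneg_right ?_ (by positivity)
    refine le_trans ?_ (deficit_le_sqrt γ _ j)
    rw [deficit, next_eq_zero_of_unused h]
    simp

/-- The squared positive part is continuously differentiable with 2-Lipschitz derivative, so its
first-order expansion errs by at most `b ^ 2`. The truncation in the deficits is therefore harmless.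
-/
theorem max_add_sq_le (a b : ℝ) : max (a + b) 0 ^ 2 ≤ max a 0 ^ 2 + 2 * max a 0 * b + b ^ 2 := by
  rcases le_total a 0 with h | h <;> rcases le_total (a + b) 0 with h' | h'
  · rw [max_eq_right h, max_eq_right h']; nlinarith
  · rw [max_eq_right h, max_eq_left h']; nlinarith
  · rw [max_eq_left h, max_eq_right h']; nlinarith
  · rw [max_eq_left h, max_eq_left h']; nlinarith

theorem abs_shift_le {γ : ℝ} (hγ : 0 ≤ γ) (hγ1 : γ ≤ 1) {q : Fin N → ℕ} {a : ℕ} {s : Fin N → ℕ}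
    {A S : ℕ} (ha : a ≤ A) (hs : ∀ n, s n ≤ S) (i n : Fin N) :
    |γ * (tot (next q a s i) - tot q) - (next q a s i n - q n)| ≤ (N + 1) * (A + S) := by
  have h1 : |tot (next q a s i) - tot q| ≤ N * (A + S) := by
    rw [tot, tot, ← Finset.sum_sub_distrib]
    refine (Finset.abs_sum_le_sum_abs _ _).trans ?_
    refine (Finset.sum_le_sum fun j _ => abs_next_sub_le ha hs i j).trans ?_
    simp [mul_add]
  have h2 := abs_next_sub_le (q := q) ha hs i n
  have h3 : |γ * (tot (next q a s i) - tot q)| ≤ N * (A + S) := by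
    rw [abs_mul, abs_of_nonneg hγ]
    exact (mul_le_of_le_one_left (abs_nonneg _) hγ1).trans h1
  have := abs_sub (γ * (tot (next q a s i) - tot q)) (next q a s i n - q n : ℝ)
  linarith

/-- Expanding each squared deficit leaves a linear term in the queue increments. Its unused-service
part costs only a constant, since service is wasted only at short queues. -/
theorem sqDeficit_next_le {γ : ℝ} (hγ : 0 ≤ γ) (hγ1 : γ ≤ 1) (hγN : γ * N ≤ 1) {q : Fin N → ℕ}
    {a : ℕ} {s : Fin N → ℕ} {A S : ℕ} (ha : a ≤ A) (hs : ∀ n, s n ≤ S) (i : Fin N) :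
    sqDeficit γ (next q a s i) ≤ sqDeficit γ q + 2 * linDrift γ q a s i +
      N * (2 * (S : ℝ) ^ 2 + ((N + 1) * (A + S) : ℝ) ^ 2) := by
  set D : Fin N → ℝ := fun n => next q a s i n - q n with hD
  have hsumD : ∑ n, D n = tot (next q a s i) - tot q := by
    simp [hD, tot, Finset.sum_sub_distrib]
  have key : sqDeficit γ (next q a s i) ≤ ∑ n, (deficit γ q n ^ 2 +
      2 * deficit γ q n * (γ * ∑ j, D j - D n) + ((N + 1) * (A + S) : ℝ) ^ 2) := by
    refine Finset.sum_le_sum fun n _ => ?_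
    have h1 : deficit γ (next q a s i) n =
        max ((γ * tot q - q n) + (γ * ∑ j, D j - D n)) 0 := by
      rw [deficit, hsumD, hD]; ring_nf
    rw [h1]
    refine (max_add_sq_le _ _).trans ?_
    have h2 : (γ * ∑ j, D j - D n) ^ 2 ≤ ((N + 1) * (A + S) : ℝ) ^ 2 := by
      rw [hsumD, ← sq_abs]
      exact pow_le_pow_left₀ (abs_nonneg _) (abs_shift_le hγ hγ1 ha hs i n) 2
    have h3 : max (γ * tot q - q n) 0 = deficit γ q n := rfl
    rw [h3]
    linarith
  refine key.trans ?_
  rw [Finset.sum_add_distrib, Finset.sum_add_distrib]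
  -- If server `j` wastes service, then `q j ≤ S`. Moreover `γ * N ≤ 1` gives `γ * ∑ deficit ≤ γ *
  -- tot q`, so the weight is at most `γ * tot q - (γ * tot q - q j) = q j`.
  have hU : ∀ j, (γ * ∑ n, deficit γ q n - deficit γ q j) * (unused q a s i j : ℝ) ≤
      (S : ℝ) ^ 2 := by
    intro j
    by_cases h : unused q a s i j = 0
    · rw [h]; simp only [Nat.cast_zero, mul_zero]; positivity
    have hq : (q j : ℝ) ≤ S := by exact_mod_cast (le_of_unused h).trans (hs j)
    have hu : (unused q a s i j : ℝ) ≤ S := by exact_mod_cast (unused_le q a s i j).trans (hs j)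
    have h1 : γ * ∑ n, deficit γ q n ≤ γ * tot q := by
      have : ∑ n, deficit γ q n ≤ N * (γ * tot q) := by
        refine (Finset.sum_le_sum fun n _ => deficit_le hγ q n).trans ?_
        simp
      calc _ ≤ γ * (N * (γ * tot q)) := mul_le_mul_of_nonneg_left this hγ
        _ = (γ * N) * (γ * tot q) := by ring
        _ ≤ _ := mul_le_of_le_one_left (mul_nonneg hγ (tot_nonneg q)) hγN
    have h2 : γ * tot q - q j ≤ deficit γ q j := le_max_left _ _
    calc _ ≤ (S : ℝ) * (unused q a s i j : ℝ) :=
          mul_le_mul_of_nonneg_right (by linarith) (by positivity)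
      _ ≤ S * S := mul_le_mul_of_nonneg_left hu (by positivity)
      _ = _ := by ring
  have hlin : ∑ n, 2 * deficit γ q n * (γ * ∑ j, D j - D n) =
      2 * linDrift γ q a s i +
        2 * ∑ j, (γ * ∑ n, deficit γ q n - deficit γ q j) * (unused q a s i j : ℝ) := by
    have e1 : ∀ j, D j = (routed a i j : ℝ) - s j + unused q a s i j := by
      intro j; simp only [hD]; rw [next_cast_real]; ring
    have e2 : ∑ n, 2 * deficit γ q n * (γ * ∑ j, D j - D n) =
        2 * ∑ j, (γ * ∑ n, deficit γ q n - deficit γ q j) * D j := by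
      simp_rw [mul_sub, sub_mul, Finset.sum_sub_distrib, mul_sub]
      congr 1
      · rw [← Finset.sum_mul, ← Finset.mul_sum, ← Finset.mul_sum]; ring
      · rw [Finset.mul_sum]; exact Finset.sum_congr rfl fun _ _ => by ring
    rw [e2, linDrift, ← mul_add, ← Finset.sum_add_distrib]
    congr 1
    refine Finset.sum_congr rfl fun j _ => ?_
    rw [e1]; ring
  have hUs : ∑ j, (γ * ∑ n, deficit γ q n - deficit γ q j) * (unused q a s i j : ℝ) ≤
      N * (S : ℝ) ^ 2 := by
    refine (Finset.sum_le_sum fun j _ => hU j).trans ?_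
    simp
  rw [hlin]
  simp only [Finset.sum_const, Finset.card_univ, Fintype.card_fin, nsmul_eq_mul]
  have : sqDeficit γ q = ∑ n, deficit γ q n ^ 2 := rfl
  linarith

/-- Each deficit moves by at most `B`, so a sum of their squares moves by `O(1 + √V)`. The squared
form is the hypothesis of `pow_succ_le_taylor`. -/
theorem sq_sqDeficit_next_sub_le {γ : ℝ} (hγ : 0 ≤ γ) (hγ1 : γ ≤ 1) {q : Fin N → ℕ}
    {a : ℕ} {s : Fin N → ℕ} {A S : ℕ} (ha : a ≤ A) (hs : ∀ n, s n ≤ S) (i : Fin N) {B : ℝ}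
    (hB : B = (N + 1) * (A + S)) :
    (sqDeficit γ (next q a s i) - sqDeficit γ q) ^ 2 ≤
      (N * B) ^ 2 * (8 + 2 * B ^ 2) * (1 + sqDeficit γ q) := by
  have hB0 : 0 ≤ B := by rw [hB]; positivity
  have hV := sqDeficit_nonneg γ q
  set W := √(sqDeficit γ q) with hW
  have hW0 : 0 ≤ W := Real.sqrt_nonneg _
  have hWV : W ^ 2 = sqDeficit γ q := Real.sq_sqrt hV
  have key : |sqDeficit γ (next q a s i) - sqDeficit γ q| ≤ N * B * (2 * W + B) := by
    rw [sqDeficit, sqDeficit, ← Finset.sum_sub_distrib]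
    refine (Finset.abs_sum_le_sum_abs _ _).trans ?_
    have : ∀ n ∈ Finset.univ, |deficit γ (next q a s i) n ^ 2 - deficit γ q n ^ 2| ≤
        B * (2 * W + B) := by
      intro n _
      have h1 : |deficit γ (next q a s i) n - deficit γ q n| ≤ B := by
        refine (abs_max_sub_max_le_abs _ _ _).trans ?_
        rw [hB]
        refine le_trans (le_of_eq ?_) (abs_shift_le (q := q) hγ hγ1 ha hs i n)
        congr 1; ring
      have h2 := deficit_le_sqrt γ q n
      have h3 := deficit_nonneg γ q n
      have h4 := deficit_nonneg γ (next q a s i) n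
      rw [sq_sub_sq, mul_comm, abs_mul, abs_of_nonneg (add_nonneg h4 h3)]
      refine mul_le_mul h1 ?_ (by positivity) hB0
      have := (abs_le.1 h1).2
      linarith
    refine (Finset.sum_le_sum this).trans ?_
    simp [mul_assoc]
  rw [← sq_abs]
  refine (pow_le_pow_left₀ (abs_nonneg _) key 2).trans ?_
  rw [mul_pow, mul_assoc ((N * B) ^ 2)]
  refine mul_le_mul_of_nonneg_left ?_ (by positivity)
  rw [← hWV]
  -- `(2W + B)² ≤ 8W² + 2B² ≤ (8 + 2B²)(1 + W²)`.
  nlinarith [sq_nonneg (2 * W - B), mul_nonneg (sq_nonneg B) (sq_nonneg W)]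

theorem sqDeficit_le {γ : ℝ} (hγ : 0 ≤ γ) (hγ1 : γ ≤ 1) (q : Fin N → ℕ) :
    sqDeficit γ q ≤ N * (1 + tot q) ^ 2 := by
  have : ∀ n ∈ Finset.univ, deficit γ q n ^ 2 ≤ (1 + tot q) ^ 2 := by
    intro n _
    refine pow_le_pow_left₀ (deficit_nonneg γ q n) ?_ 2
    have h0 := tot_nonneg q
    have := mul_le_of_le_one_left h0 hγ1
    linarith [deficit_le hγ q n]
  refine (Finset.sum_le_sum this).trans ?_
  simp

/-! ### Scalar inequalities for powers of the Lyapunov function -/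

/-- A first-order Taylor bound for the power `m + 1`, with a remainder of lower order. -/
theorem pow_succ_le_taylor (C : ℝ) (hC : 0 ≤ C) (m : ℕ) : ∃ K : ℝ, 0 ≤ K ∧ ∀ a b : ℝ, 0 ≤ a →
    0 ≤ b → (b - a) ^ 2 ≤ C * (1 + a) →
      b ^ (m + 1) ≤ a ^ (m + 1) + (m + 1) * a ^ m * (b - a) + K * (1 + a) ^ m := by
  induction m with
  | zero => exact ⟨0, le_rfl, fun a b _ _ _ => by simp⟩
  | succ m ih =>
    obtain ⟨K, hK, h⟩ := ih
    -- Multiply the inductive bound by `b = a + (b - a)`. The new errors are `(m + 1) * a ^ m * (b -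
    -- a) ^ 2`, which yields `(m + 1) * C`, and `K * (1 + a) ^ m * b`, which yields `K * (C + 2)`.
    refine ⟨(m + 1) * C + K * (C + 2), by positivity, fun a b ha hb hab => ?_⟩
    have hba : b ≤ (C + 2) * (1 + a) := by
      nlinarith [sq_nonneg (b - a - 1), mul_nonneg hC ha]
    have h1 := mul_le_mul_of_nonneg_left (h a b ha hb hab) hb
    have h2 : a ^ m * (b - a) ^ 2 ≤ C * (1 + a) ^ (m + 1) := by
      calc _ ≤ (1 + a) ^ m * (C * (1 + a)) :=
            mul_le_mul (pow_le_pow_left₀ ha (by linarith) m) hab (sq_nonneg _) (by positivity)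
        _ = _ := by ring
    have h3 : K * (1 + a) ^ m * b ≤ K * (C + 2) * (1 + a) ^ (m + 1) := by
      calc _ ≤ K * (1 + a) ^ m * ((C + 2) * (1 + a)) :=
            mul_le_mul_of_nonneg_left hba (by positivity)
        _ = _ := by ring
    have h4 := mul_le_mul_of_nonneg_left h2 (by positivity : (0 : ℝ) ≤ m + 1)
    push_cast
    calc b ^ (m + 1 + 1) = b * b ^ (m + 1) := by ring
      _ ≤ _ := h1
      _ = a ^ (m + 1 + 1) + (m + 1 + 1) * a ^ (m + 1) * (b - a) +
          ((m + 1) * (a ^ m * (b - a) ^ 2) + K * (1 + a) ^ m * b) := by ring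
      _ ≤ _ := by linarith

/-- Absorption of a lower order term into a small multiple of the higher order one. -/
theorem one_add_pow_le_absorb {v w θ : ℝ} (hw : 0 ≤ w) (hv : v = w ^ 2) (hθ : 1 ≤ θ) (m : ℕ) :
    (1 + v) ^ m ≤ 2 ^ m * (v ^ m * w / θ + θ ^ (2 * m)) := by
  subst hv
  have hθ0 : 0 < θ := by linarith
  rcases le_total w θ with h | h
  · have : (1 + w ^ 2) ^ m ≤ (2 * θ ^ 2) ^ m := by
      apply pow_le_pow_left₀ (by positivity)
      nlinarith
    refine this.trans ?_
    rw [mul_pow, ← pow_mul]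
    have : 0 ≤ (w ^ 2) ^ m * w / θ := by positivity
    gcongr
    linarith
  · have : (1 + w ^ 2) ^ m ≤ (2 * w ^ 2) ^ m := by
      apply pow_le_pow_left₀ (by positivity)
      nlinarith
    refine this.trans ?_
    rw [mul_pow]
    have h1 : (w ^ 2) ^ m ≤ (w ^ 2) ^ m * w / θ := by
      rw [le_div_iff₀ hθ0]; gcongr
    have h2 : 0 ≤ θ ^ (2 * m) := by positivity
    gcongr
    linarith

/-! ### The drift towards the cone -/

/-- With weights `w`, entry `j` is `(1 - α) * w j + α * ∑ w` and the total is `(1 + (N - 1) α) * ∑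
w`. The relation between `γ` and `α` makes `γ` times the total equal to `α * ∑ w`, which no entry
falls below. -/
theorem deficit_eq_zero_of_mem_cone {α γ : ℝ} (hα : α ∈ Icc (0 : ℝ) 1)
    (hγ : γ * (1 + (N - 1) * α) = α) {q : Fin N → ℕ} (hq : vec q ∈ cone N α) (n : Fin N) :
    deficit γ q n = 0 := by
  obtain ⟨w, hw, hx⟩ := hq
  have hcoord : ∀ j, (q j : ℝ) = (1 - α) * w j + α * ∑ i, w i := by
    intro j
    have := congrArg (fun x : EuclideanSpace ℝ (Fin N) => x j) hx
    simp only [vec, generator, PiLp.toLp_apply, WithLp.ofLp_sum, WithLp.ofLp_smul,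
      Finset.sum_apply, Pi.smul_apply, smul_eq_mul, mul_ite, mul_one] at this
    rw [this]
    have e : ∀ i, (if j = i then w i else w i * α) =
        (if j = i then (1 - α) * w i else 0) + α * w i := by
      intro i; split_ifs <;> ring
    simp_rw [e, Finset.sum_add_distrib, Finset.mul_sum]
    simp
  have htot : tot q = (1 + (N - 1) * α) * ∑ i, w i := by
    rw [tot]
    simp_rw [hcoord]
    rw [Finset.sum_add_distrib, ← Finset.mul_sum]
    simp
    ring
  rw [deficit, htot, hcoord, ← mul_assoc, hγ]
  apply max_eq_right
  have := mul_nonneg (sub_nonneg.2 hα.2) (hw n)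
  linarith

theorem antitone_deficit {γ : ℝ} {q : Fin N → ℕ} {m n : Fin N} (h : q m ≤ q n) :
    deficit γ q n ≤ deficit γ q m := by
  unfold deficit
  have : (q m : ℝ) ≤ q n := by exact_mod_cast h
  gcongr

/-- The longest queue is at least the average, and `γ ≤ 1 / N`. -/
theorem deficit_eq_zero_of_forall_le {γ : ℝ} (hγN : γ * N ≤ 1) {q : Fin N → ℕ} {n : Fin N}
    (h : ∀ j, q j ≤ q n) : deficit γ q n = 0 := by
  apply max_eq_right
  rcases le_total γ 0 with h0 | h0
  · have := mul_nonpos_of_nonpos_of_nonneg h0 (tot_nonneg q)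
    linarith [(q n).cast_nonneg (α := ℝ)]
  have : tot q ≤ N * q n := by
    refine (Finset.sum_le_sum (g := fun _ => (q n : ℝ)) fun j _ => ?_).trans ?_
    · exact_mod_cast h j
    · simp
  have h2 := mul_le_mul_of_nonneg_left this h0
  have h3 := mul_le_of_le_one_left (q n).cast_nonneg (α := ℝ) hγN
  rw [← mul_assoc] at h2
  linarith

/-- A vector with a single change of sign, tested against an antitone one. -/
theorem sum_mul_ge_of_sign_change [NeZero N] {D y : Fin N → ℝ} (hy : Antitone y) {k : Fin N}
    (hk : 0 < k) (h1 : ∀ n < k, 0 ≤ D n) (h2 : ∀ n ≥ k, D n ≤ 0) {δ : ℝ}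
    (hδ0 : δ ≤ |D 0|) (hδ1 : δ ≤ |D (Fin.rev 0)|) (hsum : ∑ n, D n = 0) :
    δ * (y 0 - y (Fin.rev 0)) ≤ ∑ n, D n * y n := by
  have hlast : ∀ n : Fin N, n ≤ Fin.rev 0 := by
    intro n; rw [Fin.le_def, Fin.val_rev]; have := n.2; simp; omega
  have hfirst : ∀ n : Fin N, 0 ≤ n := fun n => Fin.zero_le n
  -- As `D` sums to zero, `y` may be recentred at the index `k` where the sign changes. Every term
  -- is then nonnegative, and only the first and the last are kept.
  have e : ∑ n, D n * y n = ∑ n, D n * (y n - y k) := by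
    simp_rw [mul_sub, Finset.sum_sub_distrib, ← Finset.sum_mul, hsum]; simp
  have hne : (0 : Fin N) ≠ Fin.rev 0 := (hk.trans_le (hlast k)).ne
  have hnn : ∀ n, 0 ≤ D n * (y n - y k) := by
    intro n
    rcases lt_or_ge n k with h | h
    · exact mul_nonneg (h1 n h) (sub_nonneg.2 (hy h.le))
    · exact mul_nonneg_of_nonpos_of_nonpos (h2 n h) (sub_nonpos.2 (hy h))
  rw [e]
  have hpair : ∑ n ∈ {0, Fin.rev 0}, D n * (y n - y k) ≤ ∑ n, D n * (y n - y k) :=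
    Finset.sum_le_sum_of_subset_of_nonneg (Finset.subset_univ _) fun n _ _ => hnn n
  rw [Finset.sum_pair hne] at hpair
  rw [abs_of_nonneg (h1 0 hk)] at hδ0
  rw [abs_of_nonpos (h2 _ (hlast k))] at hδ1
  have a1 := mul_le_mul_of_nonneg_right hδ0 (sub_nonneg.2 (hy (hfirst k)))
  have a2 := mul_le_mul_of_nonneg_right hδ1 (sub_nonneg.2 (hy (hlast k)))
  linarith

/-! ### The one-step noise -/

/-- The randomness used in one time-slot: arrivals, services and dispatching decision. -/
abbrev Noise (N : ℕ) := ℕ × (Fin N → ℕ) × Fin N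

/-- The joint law of arrivals, services and dispatching decision in state `q`. -/
noncomputable def noise (M : Model N) (P : Policy N) (ε : ℝ) (q : Fin N → ℕ) : Measure (Noise N) :=
  (M.arr ε).toMeasure.prod
    ((Measure.pi fun n => (M.svc n).toMeasure).prod (P.dispatch q).toMeasure)

instance (M : Model N) (P : Policy N) (ε : ℝ) (q : Fin N → ℕ) :
    IsProbabilityMeasure (noise M P ε q) := by
  unfold noise; infer_instance

/-- `noise` as a kernel. -/
noncomputable def noiseKernel (M : Model N) (P : Policy N) (ε : ℝ) : Kernel (Fin N → ℕ) (Noise N) :=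
  Kernel.ofFunOfCountable (noise M P ε)

instance (M : Model N) (P : Policy N) (ε : ℝ) : IsMarkovKernel (noiseKernel M P ε) :=
  ⟨fun q => inferInstanceAs (IsProbabilityMeasure (noise M P ε q))⟩

/-- Joint law of the current state, distributed as `π`, and the noise. -/
noncomputable def joint (M : Model N) (P : Policy N) (ε : ℝ) (π : Measure (Fin N → ℕ)) :
    Measure ((Fin N → ℕ) × Noise N) :=
  π ⊗ₘ noiseKernel M P ε

/-- Next state as a function of the current state and the noise. -/
def step (ω : (Fin N → ℕ) × Noise N) : Fin N → ℕ := next ω.1 ω.2.1 ω.2.2.1 ω.2.2.2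

/-- Total unused service. -/
def waste (ω : (Fin N → ℕ) × Noise N) : ℝ := ∑ j, (unused ω.1 ω.2.1 ω.2.2.1 ω.2.2.2 j : ℝ)

/-- Total arrivals minus total offered service. -/
def netInput (z : Noise N) : ℝ := z.1 + -∑ j, (z.2.1 j : ℝ)

theorem waste_nonneg (ω : (Fin N → ℕ) × Noise N) : 0 ≤ waste ω :=
  Finset.sum_nonneg fun _ _ => by positivity

theorem tot_step (ω : (Fin N → ℕ) × Noise N) :
    tot (step ω) = tot ω.1 + netInput ω.2 + waste ω := by
  rw [step, tot_next, netInput, waste]; ring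

theorem ae_le_of_support {p : PMF ℕ} {B : ℕ} (h : ∀ k ∈ p.support, k ≤ B) :
    ∀ᵐ k ∂p.toMeasure, k ≤ B := by
  rw [ae_iff, PMF.toMeasure_apply_eq_zero_iff _ (MeasurableSet.of_discrete)]
  exact Set.disjoint_left.2 fun k hk hk' => hk' (h k hk)

theorem memLp_of_support {p : PMF ℕ} {B : ℕ} (h : ∀ k ∈ p.support, k ≤ B) (r : ℝ≥0∞) :
    MemLp (fun k : ℕ => (k : ℝ)) r p.toMeasure := by
  refine MemLp.of_bound Measurable.of_discrete.aestronglyMeasurable B ?_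
  filter_upwards [ae_le_of_support h] with k hk
  simpa using hk

theorem ae_noise {M : Model N} (P : Policy N) {ε : ℝ} (hε : ε ∈ Ioo 0 M.totalRate)
    (q : Fin N → ℕ) :
    ∀ᵐ z ∂noise M P ε q, z.1 ≤ M.Amax ∧ ∀ n, z.2.1 n ≤ M.Smax := by
  have h1 : ∀ᵐ z ∂noise M P ε q, z.1 ≤ M.Amax :=
    measurePreserving_fst.quasiMeasurePreserving.ae (ae_le_of_support (M.arr_le ε hε))
  have h2 : ∀ n, ∀ᵐ z ∂noise M P ε q, z.2.1 n ≤ M.Smax := fun n =>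
    (((measurePreserving_eval (fun n => (M.svc n).toMeasure) n).comp
      measurePreserving_fst).comp measurePreserving_snd).quasiMeasurePreserving.ae
      (ae_le_of_support (M.svc_le n))
  filter_upwards [h1, ae_all_iff.2 h2] with z a b using ⟨a, b⟩

theorem integrable_noise {M : Model N} (P : Policy N) {ε : ℝ} (hε : ε ∈ Ioo 0 M.totalRate)
    (q : Fin N → ℕ) (f : Noise N → ℝ) (C : ℝ)
    (h : ∀ z : Noise N, z.1 ≤ M.Amax → (∀ n, z.2.1 n ≤ M.Smax) → |f z| ≤ C) :
    Integrable f (noise M P ε q) := by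
  refine Integrable.of_bound Measurable.of_discrete.aestronglyMeasurable C ?_
  filter_upwards [ae_noise P hε q] with z hz using h z hz.1 hz.2

theorem integral_svc (M : Model N) (P : Policy N) (ε : ℝ) (q : Fin N → ℕ) (j : Fin N) :
    ∫ z, (z.2.1 j : ℝ) ∂noise M P ε q = M.rate j := by
  have h := ((measurePreserving_eval (fun n => (M.svc n).toMeasure) j).comp
      (measurePreserving_fst (ν := (P.dispatch q).toMeasure))).comp
      (measurePreserving_snd (μ := (M.arr ε).toMeasure))
  rw [Model.rate, mean, ← h.map_eq, integral_map h.aemeasurable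
    Measurable.of_discrete.aestronglyMeasurable]
  rfl

theorem integral_arr_mul (M : Model N) (P : Policy N) (ε : ℝ) (q : Fin N → ℕ) (g : Fin N → ℝ) :
    ∫ z, (z.1 : ℝ) * g z.2.2 ∂noise M P ε q =
      mean (M.arr ε) * ∑ i, (P.dispatch q i).toReal * g i := by
  rw [noise, integral_prod_mul (fun a : ℕ => (a : ℝ)) (fun p : (Fin N → ℕ) × Fin N => g p.2),
    integral_fun_snd, PMF.integral_eq_sum (P.dispatch q)]
  simp [mean]

/-- Conditioning on the tie-breaking permutation, because the hypothesis on `Delta` is stated for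
each permutation separately. -/
theorem sum_dispatch_mul (P : Policy N) (q : Fin N → ℕ) (g : Fin N → ℝ) :
    ∑ i, (P.dispatch q i).toReal * g i =
      ∑ σ, (P.tie q σ).toReal * ∑ n, (P.rank q σ n).toReal * g (σ n) := by
  have h : ∀ i, (P.dispatch q i).toReal =
      ∑ σ, (P.tie q σ).toReal * ∑ n, if i = σ n then (P.rank q σ n).toReal else 0 := by
    intro i
    rw [Policy.dispatch, PMF.bind_apply, tsum_fintype, ENNReal.toReal_sum]
    · refine Finset.sum_congr rfl fun σ _ => ?_
      rw [ENNReal.toReal_mul, PMF.map_apply, tsum_fintype, ENNReal.toReal_sum]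
      · congr 1
        refine Finset.sum_congr rfl fun n _ => ?_
        split_ifs <;> simp
      · intro n _
        split_ifs
        · exact PMF.apply_ne_top _ _
        · simp
    · intro σ _
      exact ENNReal.mul_ne_top (PMF.apply_ne_top _ _) (PMF.apply_ne_top _ _)
  simp_rw [h, Finset.sum_mul]
  rw [Finset.sum_comm]
  refine Finset.sum_congr rfl fun σ _ => ?_
  simp_rw [mul_assoc, ← Finset.mul_sum, Finset.sum_mul]
  rw [Finset.sum_comm]
  congr 1
  refine Finset.sum_congr rfl fun n _ => ?_
  simp

theorem sum_toReal_pmf {ι : Type*} [Fintype ι] (p : PMF ι) : ∑ i, (p i).toReal = 1 := by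
  rw [← ENNReal.toReal_sum fun i _ => PMF.apply_ne_top _ _,
    ← tsum_fintype (L := .unconditional _), p.tsum_coe]
  simp

theorem rate_nonneg (M : Model N) (n : Fin N) : 0 ≤ M.rate n :=
  integral_nonneg fun _ => by positivity

theorem totalRate_pos (M : Model N) : 0 < M.totalRate := M.totalRate_pos

theorem mean_arr {M : Model N} {ε : ℝ} (hε : ε ∈ Ioo 0 M.totalRate) :
    mean (M.arr ε) = M.totalRate - ε := M.mean_arr ε hε

theorem memLp_netInput_svc (M : Model N) (p : PMF (Fin N)) :
    MemLp (fun z : (Fin N → ℕ) × Fin N => -∑ j, (z.1 j : ℝ)) 2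
      ((Measure.pi fun n => (M.svc n).toMeasure).prod p.toMeasure) := by
  refine MemLp.of_bound Measurable.of_discrete.aestronglyMeasurable (N * M.Smax) ?_
  have h2 : ∀ n, ∀ᵐ z ∂((Measure.pi fun n => (M.svc n).toMeasure).prod p.toMeasure),
      z.1 n ≤ M.Smax := fun n =>
    ((measurePreserving_eval (fun n => (M.svc n).toMeasure) n).comp
      measurePreserving_fst).quasiMeasurePreserving.ae (ae_le_of_support (M.svc_le n))
  filter_upwards [ae_all_iff.2 h2] with z hz
  rw [norm_neg, Real.norm_of_nonneg (by positivity)]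
  refine (Finset.sum_le_sum (g := fun _ => (M.Smax : ℝ)) fun j _ => ?_).trans (by simp)
  exact_mod_cast hz j

theorem variance_netInput {M : Model N} (P : Policy N) {ε : ℝ} (hε : ε ∈ Ioo 0 M.totalRate)
    (q : Fin N → ℕ) :
    Var[netInput; noise M P ε q] = var (M.arr ε) + M.totalSvcVar := by
  have h1 := variance_add_prod (memLp_of_support (M.arr_le ε hε) 2)
    (memLp_netInput_svc M (P.dispatch q))
  have h2 : Var[fun z : (Fin N → ℕ) × Fin N => -∑ j, (z.1 j : ℝ);
      (Measure.pi fun n => (M.svc n).toMeasure).prod (P.dispatch q).toMeasure] =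
      M.totalSvcVar := by
    have h3 := variance_sum_pi (μ := fun n => (M.svc n).toMeasure)
      (X := fun _ (k : ℕ) => (k : ℝ)) fun n => memLp_of_support (M.svc_le n) 2
    have h4 := (measurePreserving_fst (μ := Measure.pi fun n => (M.svc n).toMeasure)
      (ν := (P.dispatch q).toMeasure)).variance_fun_comp
      (f := fun s : Fin N → ℕ => ∑ j, (s j : ℝ)) Measurable.of_discrete.aemeasurable
    rw [variance_fun_neg, h4, Model.totalSvcVar]
    simp only [var]
    rw [← h3]
    congr 1
    ext s
    simp
  rw [h2] at h1
  exact h1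

theorem abs_netInput_le {M : Model N} {z : Noise N} (h1 : z.1 ≤ M.Amax)
    (h2 : ∀ n, z.2.1 n ≤ M.Smax) : |netInput z| ≤ M.Amax + N * M.Smax := by
  rw [netInput]
  have h3 : ∑ j, (z.2.1 j : ℝ) ≤ N * M.Smax := by
    refine (Finset.sum_le_sum (g := fun _ => (M.Smax : ℝ)) fun j _ => ?_).trans (by simp)
    exact_mod_cast h2 j
  have h4 : (0 : ℝ) ≤ ∑ j, (z.2.1 j : ℝ) := by positivity
  have h5 : (z.1 : ℝ) ≤ M.Amax := by exact_mod_cast h1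
  have h6 : (0 : ℝ) ≤ z.1 := by positivity
  rw [abs_le]
  constructor <;> nlinarith

theorem integral_netInput {M : Model N} (P : Policy N) {ε : ℝ} (hε : ε ∈ Ioo 0 M.totalRate)
    (q : Fin N → ℕ) : ∫ z, netInput z ∂noise M P ε q = -ε := by
  have hs : ∀ j, Integrable (fun z : Noise N => (z.2.1 j : ℝ)) (noise M P ε q) := fun j =>
    integrable_noise P hε q _ M.Smax fun z _ h => by simpa using h j
  have ha : Integrable (fun z : Noise N => (z.1 : ℝ)) (noise M P ε q) :=
    integrable_noise P hε q _ M.Amax fun z h _ => by simpa using h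
  have e := integral_arr_mul M P ε q (fun _ => 1)
  simp only [mul_one, sum_toReal_pmf, mean_arr hε] at e
  have hS : Integrable (fun z : Noise N => -∑ j, (z.2.1 j : ℝ)) (noise M P ε q) :=
    (integrable_finsetSum _ fun j _ => hs j).neg
  unfold netInput
  rw [integral_add ha hS, integral_neg, integral_finsetSum _ fun j _ => hs j, e]
  simp_rw [integral_svc]
  rw [Model.totalRate]
  ring

theorem integral_netInput_sq {M : Model N} (P : Policy N) {ε : ℝ}
    (hε : ε ∈ Ioo 0 M.totalRate) (q : Fin N → ℕ) :
    ∫ z, netInput z ^ 2 ∂noise M P ε q = var (M.arr ε) + M.totalSvcVar + ε ^ 2 := by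
  have hX : MemLp netInput 2 (noise M P ε q) := by
    refine MemLp.of_bound Measurable.of_discrete.aestronglyMeasurable (M.Amax + N * M.Smax) ?_
    filter_upwards [ae_noise P hε q] with z hz using abs_netInput_le hz.1 hz.2
  have h := variance_eq_sub hX
  rw [variance_netInput P hε, integral_netInput P hε] at h
  simp only [Pi.pow_apply] at h
  linarith

/-- In a state outside the cone, routing favours the shorter queues, so that the linear part of
the drift is negative, of the order of the largest deficit. -/
theorem integral_linDrift_le [NeZero N] {M : Model N} {P : Policy N} {ε : ℝ}
    (hε : ε ∈ Ioo 0 M.totalRate) {α γ δ : ℝ} (hα : α ∈ Icc (0 : ℝ) 1)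
    (hγ : γ * (1 + (N - 1) * α) = α) (hγN : γ * N ≤ 1) (hΔ : FavoursShorter M P α δ)
    (h1 : ε ≤ M.totalRate / 2) (h2 : ε ≤ M.totalRate * δ / 4) (q : Fin N → ℕ) :
    ∫ z, linDrift γ q z.1 z.2.1 z.2.2 ∂noise M P ε q ≤
      -(M.totalRate / (4 * N) * δ) * √(sqDeficit γ q) := by
  have hN : (0 : ℝ) < N := by exact_mod_cast Nat.pos_of_ne_zero (NeZero.ne N)
  have hμ := totalRate_pos M
  set y := deficit γ q with hy
  set Y := γ * ∑ n, y n with hY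
  have hs : ∀ j, Integrable (fun z : Noise N => (Y - y j) * (z.2.1 j : ℝ)) (noise M P ε q) :=
    fun j => (integrable_noise P hε q _ M.Smax fun z _ h => by simpa using h j).const_mul _
  have ha : Integrable (fun z : Noise N => (z.1 : ℝ) * (Y - y z.2.2)) (noise M P ε q) := by
    refine integrable_noise P hε q _ (M.Amax * ∑ i, |Y - y i|) fun z h _ => ?_
    rw [abs_mul]
    refine mul_le_mul (by simpa using h) ?_ (abs_nonneg _) (by positivity)
    exact Finset.single_le_sum (f := fun i => |Y - y i|) (fun _ _ => abs_nonneg _)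
      (Finset.mem_univ z.2.2)
  have e1 : ∀ z : Noise N, linDrift γ q z.1 z.2.1 z.2.2 =
      (z.1 : ℝ) * (Y - y z.2.2) - ∑ j, (Y - y j) * (z.2.1 j : ℝ) := by
    intro z
    rw [linDrift]
    simp_rw [mul_sub, Finset.sum_sub_distrib]
    congr 1
    simp [routed, Y, y]
    ring
  simp_rw [e1]
  rw [integral_sub ha (integrable_finsetSum _ fun j _ => hs j),
    integral_finsetSum _ fun j _ => hs j, integral_arr_mul M P ε q (fun i => Y - y i)]
  simp_rw [integral_const_mul, integral_svc]
  rw [mean_arr hε, sum_dispatch_mul]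
  by_cases hq : vec q ∈ cone N α
  · have h0 : ∀ n, deficit γ q n = 0 := deficit_eq_zero_of_mem_cone hα hγ hq
    simp [y, Y, h0, sqDeficit]
  obtain ⟨σ₀, hσ₀⟩ := (P.tie q).support_nonempty
  have hδ : 0 ≤ M.totalRate * δ := by linarith [hε.1]
  set ymax := y (σ₀ 0) with hymax
  have hrate : ∀ σ : Equiv.Perm (Fin N), ∑ n, M.rate (σ n) = M.totalRate := fun σ =>
    Equiv.sum_comp σ M.rate
  have hle : ∀ σ ∈ (P.tie q).support, ∀ n, q (σ 0) ≤ q n := by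
    intro σ hσ n
    have := P.tie_sorted q σ hσ (Fin.zero_le (σ.symm n))
    simpa using this
  -- The largest deficit belongs to a shortest queue, so its value does not depend on how ties are
  -- broken.
  have hymax' : ∀ σ ∈ (P.tie q).support, y (σ 0) = ymax := by
    intro σ hσ
    exact le_antisymm (antitone_deficit (hle σ₀ hσ₀ _)) (antitone_deficit (hle σ hσ _))
  have hyle : ∀ n, y n ≤ ymax := fun n => antitone_deficit (hle σ₀ hσ₀ n)
  have hyn : ∀ n, 0 ≤ y n := deficit_nonneg γ q
  have key : ∀ σ ∈ (P.tie q).support, δ * ymax ≤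
      ∑ n, (P.rank q σ n).toReal * y (σ n) - (∑ n, M.rate n * y n) / M.totalRate := by
    intro σ hσ
    obtain ⟨⟨k, hk, hk1, hk2⟩, hmin⟩ := hΔ q hq σ hσ
    have hanti : Antitone fun n => y (σ n) := fun m n hmn =>
      antitone_deficit (P.tie_sorted q σ hσ hmn)
    have hsum : ∑ n, Delta M P q σ n = 0 := by
      simp_rw [Delta, Finset.sum_sub_distrib, sum_toReal_pmf, ← Finset.sum_div, hrate,
        div_self hμ.ne', sub_self]
    have h := sum_mul_ge_of_sign_change hanti hk hk1 hk2 (hmin.trans (min_le_left _ _))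
      (hmin.trans (min_le_right _ _)) hsum
    have hlast : y (σ (Fin.rev 0)) = 0 := by
      refine deficit_eq_zero_of_forall_le hγN fun j => ?_
      have hj : σ.symm j ≤ Fin.rev 0 := by
        rw [Fin.le_def, Fin.val_rev]; have := (σ.symm j).2; simp; omega
      have := P.tie_sorted q σ hσ hj
      simpa using this
    rw [hlast, sub_zero, hymax' σ hσ] at h
    refine h.trans (le_of_eq ?_)
    simp_rw [Delta, sub_mul, Finset.sum_sub_distrib]
    congr 1
    rw [← Equiv.sum_comp σ fun n => M.rate n * y n, Finset.sum_div]
    exact Finset.sum_congr rfl fun n _ => by ring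
  have e2 : ∀ σ, ∑ n, (P.rank q σ n).toReal * (Y - y (σ n)) =
      Y - ∑ n, (P.rank q σ n).toReal * y (σ n) := by
    intro σ
    simp_rw [mul_sub, Finset.sum_sub_distrib, ← Finset.sum_mul, sum_toReal_pmf, one_mul]
  simp_rw [e2]
  set R := ∑ n, M.rate n * y n with hR
  have hRle : R ≤ M.totalRate * ymax := by
    rw [Model.totalRate, Finset.sum_mul]
    exact Finset.sum_le_sum fun n _ => mul_le_mul_of_nonneg_left (hyle n) (rate_nonneg M n)
  have hY0 : 0 ≤ Y := by
    have h1N : (1 : ℝ) ≤ N := by exact_mod_cast Nat.one_le_iff_ne_zero.2 (NeZero.ne N)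
    have hγ0 : 0 ≤ γ := by
      by_contra! hneg
      have hp : (0 : ℝ) < 1 + (N - 1) * α := by nlinarith [hα.1]
      have := mul_neg_of_neg_of_pos hneg hp
      linarith [hα.1]
    exact mul_nonneg hγ0 (Finset.sum_nonneg fun n _ => hyn n)
  have hdisp : ∑ σ, (P.tie q σ).toReal * (Y - ∑ n, (P.rank q σ n).toReal * y (σ n)) ≤
      Y - δ * ymax - R / M.totalRate := by
    have : ∀ σ ∈ Finset.univ,
        (P.tie q σ).toReal * (Y - ∑ n, (P.rank q σ n).toReal * y (σ n)) ≤
          (P.tie q σ).toReal * (Y - δ * ymax - R / M.totalRate) := by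
      intro σ _
      by_cases hσ : σ ∈ (P.tie q).support
      · exact mul_le_mul_of_nonneg_left (by linarith [key σ hσ]) ENNReal.toReal_nonneg
      · rw [PMF.mem_support_iff, not_not] at hσ
        simp [hσ]
    refine (Finset.sum_le_sum this).trans ?_
    rw [← Finset.sum_mul, sum_toReal_pmf, one_mul]
  have e3 : ∑ j, (Y - y j) * M.rate j = M.totalRate * Y - R := by
    simp_rw [sub_mul, Finset.sum_sub_distrib, ← Finset.mul_sum, hR]
    rw [Model.totalRate, mul_comm]
    congr 1
    exact Finset.sum_congr rfl fun n _ => mul_comm _ _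
  rw [e3]
  have hW : √(sqDeficit γ q) ≤ N * ymax := by
    have h1N : (1 : ℝ) ≤ N := by exact_mod_cast Nat.one_le_iff_ne_zero.2 (NeZero.ne N)
    rw [Real.sqrt_le_left (mul_nonneg hN.le (hyn _))]
    have : sqDeficit γ q ≤ N * ymax ^ 2 := by
      refine (Finset.sum_le_sum (g := fun _ => ymax ^ 2) fun n _ => ?_).trans (by simp)
      exact pow_le_pow_left₀ (hyn n) (hyle n) 2
    nlinarith [sq_nonneg ymax]
  have hym : 0 ≤ ymax := hyn _
  have hfin : -(M.totalRate * δ / 4 * ymax) ≤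
      -(M.totalRate / (4 * N) * δ) * √(sqDeficit γ q) := by
    have := mul_le_mul_of_nonneg_left hW (by positivity : 0 ≤ M.totalRate * δ / (4 * N))
    have e : M.totalRate * δ / (4 * N) * (N * ymax) = M.totalRate * δ / 4 * ymax := by
      field_simp
    rw [e] at this
    have e' : -(M.totalRate / (4 * N) * δ) * √(sqDeficit γ q) =
      -(M.totalRate * δ / (4 * N) * √(sqDeficit γ q)) := by ring
    rw [e']
    linarith
  refine le_trans ?_ hfin
  have ha0 : 0 ≤ M.totalRate - ε := by linarith [hε.2]
  have b1 := mul_le_mul_of_nonneg_left hdisp ha0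
  -- Routing gains `(μ_Σ - ε) * δ * ymax`, at least `μ_Σ * δ / 2 * ymax`. The missing load costs at
  -- most `ε * ymax`, hence at most half of that gain. The remaining `μ_Σ * δ / 4 * ymax` and `√V ≤
  -- N * ymax` give the constant `μ_Σ / (4N)`.
  have b2 : (M.totalRate - ε) * (Y - δ * ymax - R / M.totalRate) - (M.totalRate * Y - R) =
      -ε * Y - (M.totalRate - ε) * δ * ymax + ε * (R / M.totalRate) := by
    field_simp
    ring
  have b3 : R / M.totalRate ≤ ymax := by
    rw [div_le_iff₀ hμ]; linarith
  have b4 := mul_le_mul_of_nonneg_left b3 hε.1.le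
  have b5 := mul_nonneg hε.1.le hY0
  have hδ' : 0 ≤ δ := nonneg_of_mul_nonneg_right hδ hμ
  have b6 : M.totalRate * δ / 2 * ymax ≤ (M.totalRate - ε) * δ * ymax := by
    refine mul_le_mul_of_nonneg_right ?_ hym
    nlinarith
  have b7 := mul_le_mul_of_nonneg_right h2 hym
  linarith

/-- The parameter `δ` in `FavoursShorter` is at most `1` unless there is no deficit at all. -/
theorem FavoursShorter.le_one_or [NeZero N] {M : Model N} {P : Policy N} {α γ δ : ℝ}
    (hα : α ∈ Icc (0 : ℝ) 1) (hγ : γ * (1 + (N - 1) * α) = α) (hΔ : FavoursShorter M P α δ) :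
    δ ≤ 1 ∨ ∀ q : Fin N → ℕ, sqDeficit γ q = 0 := by
  by_cases h : ∀ q : Fin N → ℕ, vec q ∈ cone N α
  · right
    intro q
    simp [sqDeficit, deficit_eq_zero_of_mem_cone hα hγ (h q)]
  · left
    push Not at h
    obtain ⟨q, hq⟩ := h
    obtain ⟨σ, hσ⟩ := (P.tie q).support_nonempty
    obtain ⟨⟨k, hk, hk1, -⟩, hmin⟩ := hΔ q hq σ hσ
    refine (hmin.trans (min_le_left _ _)).trans ?_
    rw [abs_of_nonneg (hk1 0 hk), Delta]
    have h1 : (P.rank q σ 0).toReal ≤ 1 :=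
      ENNReal.toReal_le_of_le_ofReal zero_le_one (by simpa using PMF.coe_le_one _ _)
    have h2 : 0 ≤ M.rate (σ 0) / M.totalRate :=
      div_nonneg (rate_nonneg M _) (totalRate_pos M).le
    linarith

/-! ### Steady-state identities -/

theorem integrable_one_add_tot_pow {π : Measure (Fin N → ℕ)} [IsProbabilityMeasure π]
    (hmom : ∀ r : ℕ, ∫⁻ q, ‖vec q‖ₑ ^ r ∂π < ∞) (r : ℕ) :
    Integrable (fun q => (1 + tot q) ^ r) π := by
  have h1 : Integrable (fun q : Fin N → ℕ => ‖vec q‖ ^ r) π := by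
    refine ⟨Measurable.of_discrete.aestronglyMeasurable, ?_⟩
    rw [HasFiniteIntegral]
    simpa [enorm_pow] using hmom r
  refine Integrable.mono' (((integrable_const (1 : ℝ)).add (h1.const_mul ((N : ℝ) ^ r))).const_mul
    (2 ^ (r - 1))) Measurable.of_discrete.aestronglyMeasurable (ae_of_all _ fun q => ?_)
  have h0 := tot_nonneg q
  have h2 : tot q ≤ N * ‖vec q‖ := by
    refine (Finset.sum_le_sum (g := fun _ => ‖vec q‖) fun n _ => ?_).trans (by simp)
    have := PiLp.norm_apply_le (vec q) n
    simpa [vec] using this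
  rw [Real.norm_of_nonneg (by positivity)]
  calc (1 + tot q) ^ r ≤ (1 + N * ‖vec q‖) ^ r :=
        pow_le_pow_left₀ (by positivity) (by linarith) r
    _ ≤ 2 ^ (r - 1) * (1 ^ r + (N * ‖vec q‖) ^ r) := add_pow_le zero_le_one (by positivity) r
    _ = _ := by simp [mul_pow]

theorem one_add_sqDeficit_pow_le {γ : ℝ} (hγ : 0 ≤ γ) (hγ1 : γ ≤ 1) (q : Fin N → ℕ) (r : ℕ) :
    (1 + sqDeficit γ q) ^ r ≤ (1 + N) ^ r * (1 + tot q) ^ (2 * r) := by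
  have h0 := tot_nonneg q
  have h1 := sqDeficit_nonneg γ q
  rw [pow_mul, ← mul_pow]
  refine pow_le_pow_left₀ (by positivity) ?_ r
  nlinarith [sqDeficit_le hγ hγ1 q]

theorem sqrt_le_one_add {x : ℝ} (hx : 0 ≤ x) : √x ≤ 1 + x :=
  Real.sqrt_le_iff.2 ⟨by linarith, by nlinarith⟩

theorem sqDeficit_pow_mul_sqrt_le (γ : ℝ) (q : Fin N → ℕ) (m : ℕ) :
    sqDeficit γ q ^ m * √(sqDeficit γ q) ≤ (1 + sqDeficit γ q) ^ (m + 1) := by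
  have h1 := sqDeficit_nonneg γ q
  rw [pow_succ]
  gcongr
  · linarith
  · exact sqrt_le_one_add h1

section joint

variable {M : Model N} {P : ℝ → Policy N} {ε : ℝ} {π : Measure (Fin N → ℕ)}

instance [IsProbabilityMeasure π] (Q : Policy N) : IsProbabilityMeasure (joint M Q ε π) := by
  unfold joint; infer_instance

theorem map_fst_joint [IsProbabilityMeasure π] (Q : Policy N) :
    (joint M Q ε π).map Prod.fst = π := Measure.fst_compProd π _

/-- Under an invariant law the state after one step is again distributed as `π`; hence every
integrable function has zero mean increment. -/
theorem map_step_joint [IsProbabilityMeasure π] (hinv : (transition M P ε).Invariant π) :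
    (joint M (P ε) ε π).map step = π := by
  ext t ht
  rw [Measure.map_apply Measurable.of_discrete ht, joint,
    Measure.compProd_apply MeasurableSet.of_discrete]
  conv_rhs => rw [← hinv.def]
  rw [Measure.bind_apply ht (Kernel.aemeasurable _)]
  refine lintegral_congr fun q => ?_
  have e : transition M P ε q = (noise M (P ε) ε q).map fun z => next q z.1 z.2.1 z.2.2 := rfl
  rw [e, Measure.map_apply Measurable.of_discrete ht]
  rfl

theorem ae_joint [IsProbabilityMeasure π] (Q : Policy N) (hε : ε ∈ Ioo 0 M.totalRate) :
    ∀ᵐ ω ∂joint M Q ε π, ω.2.1 ≤ M.Amax ∧ ∀ n, ω.2.2.1 n ≤ M.Smax :=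
  Measure.ae_compProd_of_ae_ae MeasurableSet.of_discrete (ae_of_all _ fun q => ae_noise Q hε q)

theorem integrable_fst [IsProbabilityMeasure π] (Q : Policy N) {g : (Fin N → ℕ) → ℝ}
    (hg : Integrable g π) : Integrable (fun ω => g ω.1) (joint M Q ε π) := by
  rw [← map_fst_joint (M := M) (ε := ε) (π := π) Q] at hg
  exact hg.comp_measurable measurable_fst

theorem integral_fst [IsProbabilityMeasure π] (Q : Policy N) (g : (Fin N → ℕ) → ℝ) :
    ∫ ω, g ω.1 ∂joint M Q ε π = ∫ q, g q ∂π := by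
  conv_rhs => rw [← map_fst_joint (M := M) (ε := ε) (π := π) Q]
  rw [integral_map measurable_fst.aemeasurable Measurable.of_discrete.aestronglyMeasurable]

theorem integrable_step [IsProbabilityMeasure π] (hinv : (transition M P ε).Invariant π)
    {g : (Fin N → ℕ) → ℝ} (hg : Integrable g π) :
    Integrable (fun ω => g (step ω)) (joint M (P ε) ε π) := by
  rw [← map_step_joint hinv] at hg
  exact hg.comp_measurable Measurable.of_discrete

theorem integral_step [IsProbabilityMeasure π] (hinv : (transition M P ε).Invariant π)
    (g : (Fin N → ℕ) → ℝ) :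
    ∫ ω, g (step ω) ∂joint M (P ε) ε π = ∫ q, g q ∂π := by
  conv_rhs => rw [← map_step_joint hinv]
  rw [integral_map Measurable.of_discrete.aemeasurable Measurable.of_discrete.aestronglyMeasurable]

theorem integrable_joint [IsProbabilityMeasure π] (Q : Policy N) (hε : ε ∈ Ioo 0 M.totalRate)
    {g : (Fin N → ℕ) → ℝ} (hg : Integrable g π) {f : (Fin N → ℕ) × Noise N → ℝ}
    (h : ∀ ω : (Fin N → ℕ) × Noise N, ω.2.1 ≤ M.Amax → (∀ n, ω.2.2.1 n ≤ M.Smax) →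
      |f ω| ≤ g ω.1) : Integrable f (joint M Q ε π) := by
  refine Integrable.mono' (integrable_fst Q hg) Measurable.of_discrete.aestronglyMeasurable ?_
  filter_upwards [ae_joint Q hε] with ω hω using h ω hω.1 hω.2

theorem waste_le {ω : (Fin N → ℕ) × Noise N} (h : ∀ n, ω.2.2.1 n ≤ M.Smax) :
    waste ω ≤ N * M.Smax := by
  refine (Finset.sum_le_sum (g := fun _ => (M.Smax : ℝ)) fun j _ => ?_).trans (by simp)
  exact_mod_cast (unused_le _ _ _ _ _).trans (h j)

theorem integrable_tot [IsProbabilityMeasure π]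
    (hmom : ∀ r : ℕ, ∫⁻ q, ‖vec q‖ₑ ^ r ∂π < ∞) : Integrable (fun q => tot q) π := by
  have := (integrable_one_add_tot_pow hmom 1).sub (integrable_const (1 : ℝ))
  refine this.congr (ae_of_all _ fun q => ?_)
  simp

theorem integrable_waste [IsProbabilityMeasure π] (Q : Policy N)
    (hε : ε ∈ Ioo 0 M.totalRate) : Integrable waste (joint M Q ε π) :=
  integrable_joint Q hε (integrable_const (N * M.Smax : ℝ)) fun ω _ h => by
    rw [abs_of_nonneg (waste_nonneg ω)]; exact waste_le h

theorem integrable_netInput [IsProbabilityMeasure π] (Q : Policy N)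
    (hε : ε ∈ Ioo 0 M.totalRate) :
    Integrable (fun ω => netInput ω.2) (joint M Q ε π) :=
  integrable_joint Q hε (integrable_const (M.Amax + N * M.Smax : ℝ)) fun _ h1 h2 =>
    abs_netInput_le h1 h2

/-- In steady-state the mean unused service equals the excess capacity. -/
theorem integral_waste [IsProbabilityMeasure π] (hε : ε ∈ Ioo 0 M.totalRate)
    (hinv : (transition M P ε).Invariant π) (hmom : ∀ r : ℕ, ∫⁻ q, ‖vec q‖ₑ ^ r ∂π < ∞) :
    ∫ ω, waste ω ∂joint M (P ε) ε π = ε := by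
  have ht := integrable_tot hmom
  have h1 := integral_step hinv tot
  simp_rw [tot_step] at h1
  have hQX : Integrable (fun ω => tot ω.1 + netInput ω.2) (joint M (P ε) ε π) :=
    (integrable_fst _ ht).add (integrable_netInput _ hε)
  rw [integral_add hQX (integrable_waste _ hε),
    integral_add (integrable_fst _ ht) (integrable_netInput _ hε), integral_fst] at h1
  have h2 : ∫ ω, netInput ω.2 ∂joint M (P ε) ε π = -ε := by
    rw [joint, Measure.integral_compProd (integrable_netInput (P ε) hε)]
    have : ∀ q, ∫ z, netInput z ∂noiseKernel M (P ε) ε q = -ε :=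
      fun q => integral_netInput (P ε) hε q
    simp [this]
  linarith

/-- The drift of the squared total queue length vanishes in steady-state. -/
theorem two_mul_integral_tot_le [IsProbabilityMeasure π] (hε : ε ∈ Ioo 0 M.totalRate)
    (hinv : (transition M P ε).Invariant π) (hmom : ∀ r : ℕ, ∫⁻ q, ‖vec q‖ₑ ^ r ∂π < ∞) :
    2 * ε * ∫ q, tot q ∂π ≤ var (M.arr ε) + M.totalSvcVar + ε ^ 2 +
      2 * ∫ ω, tot (step ω) * waste ω ∂joint M (P ε) ε π := by
  have ht := integrable_tot hmom
  have ht2 : Integrable (fun q => tot q ^ 2) π := by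
    refine Integrable.mono' (integrable_one_add_tot_pow hmom 2)
      Measurable.of_discrete.aestronglyMeasurable (ae_of_all _ fun q => ?_)
    have := tot_nonneg q
    rw [Real.norm_of_nonneg (by positivity)]
    gcongr
    linarith
  have hQX : Integrable (fun ω => tot ω.1 * netInput ω.2) (joint M (P ε) ε π) :=
    integrable_joint _ hε (ht.mul_const (M.Amax + N * M.Smax : ℝ)) fun ω h1 h2 => by
      rw [abs_mul, abs_of_nonneg (tot_nonneg _)]
      exact mul_le_mul_of_nonneg_left (abs_netInput_le h1 h2) (tot_nonneg _)
  have hX2 : Integrable (fun ω => netInput ω.2 ^ 2) (joint M (P ε) ε π) :=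
    integrable_joint _ hε (integrable_const ((M.Amax + N * M.Smax : ℝ) ^ 2)) fun ω h1 h2 => by
      rw [abs_pow]
      exact pow_le_pow_left₀ (abs_nonneg _) (abs_netInput_le h1 h2) 2
  have hSW : Integrable (fun ω => tot (step ω) * waste ω) (joint M (P ε) ε π) := by
    refine Integrable.mono' ((integrable_step hinv ht).mul_const (N * M.Smax : ℝ))
      Measurable.of_discrete.aestronglyMeasurable ?_
    filter_upwards [ae_joint (P ε) hε] with ω hω
    rw [Real.norm_of_nonneg (mul_nonneg (tot_nonneg _) (waste_nonneg _))]
    exact mul_le_mul_of_nonneg_left (waste_le hω.2) (tot_nonneg _)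
  have hsum : Integrable (fun ω => tot ω.1 ^ 2 + 2 * (tot ω.1 * netInput ω.2))
      (joint M (P ε) ε π) := (integrable_fst _ ht2).add (hQX.const_mul 2)
  have hsum' : Integrable (fun ω => tot ω.1 ^ 2 + 2 * (tot ω.1 * netInput ω.2) +
      netInput ω.2 ^ 2) (joint M (P ε) ε π) := hsum.add hX2
  have key : ∫ ω, tot (step ω) ^ 2 ∂joint M (P ε) ε π ≤
      ∫ ω, (tot ω.1 ^ 2 + 2 * (tot ω.1 * netInput ω.2) + netInput ω.2 ^ 2 +
        2 * (tot (step ω) * waste ω)) ∂joint M (P ε) ε π := by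
    refine integral_mono (integrable_step hinv ht2)
      (hsum'.add (hSW.const_mul 2)) fun ω => ?_
    -- With `X` the net input and `U` the waste, `(Q + X + U)² = (Q + X)² + 2 (Q + X + U) U - U²`,
    -- and `-U²` is dropped.
    simp only [tot_step]
    nlinarith [sq_nonneg (waste ω)]
  rw [integral_step hinv fun q => tot q ^ 2,
    integral_add hsum' (hSW.const_mul 2), integral_add hsum hX2,
    integral_add (integrable_fst _ ht2) (hQX.const_mul 2),
    integral_fst (g := fun q => tot q ^ 2), integral_const_mul, integral_const_mul] at key
  have e1 : ∫ ω, tot ω.1 * netInput ω.2 ∂joint M (P ε) ε π = -ε * ∫ q, tot q ∂π := by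
    rw [joint, Measure.integral_compProd hQX, ← integral_const_mul]
    refine integral_congr_ae (ae_of_all _ fun q => ?_)
    simp only
    rw [integral_const_mul, mul_comm]
    congr 1
    exact integral_netInput (P ε) hε q
  have e2 : ∫ ω, netInput ω.2 ^ 2 ∂joint M (P ε) ε π =
      var (M.arr ε) + M.totalSvcVar + ε ^ 2 := by
    rw [joint, Measure.integral_compProd hX2]
    have : ∀ q, ∫ z, netInput z ^ 2 ∂noiseKernel M (P ε) ε q =
      var (M.arr ε) + M.totalSvcVar + ε ^ 2 := fun q => integral_netInput_sq (P ε) hε q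
    simp [this]
  rw [e1, e2] at key
  linarith

end joint

/-- A crude bound, needed only for integrability. -/
theorem abs_linDrift_le {γ : ℝ} (hγ : 0 ≤ γ) (hγ1 : γ ≤ 1) (q : Fin N → ℕ) {a : ℕ}
    {s : Fin N → ℕ} {A S : ℕ} (ha : a ≤ A) (hs : ∀ n, s n ≤ S) (i : Fin N) :
    |linDrift γ q a s i| ≤ N * (N + 1) * (A + S) * (1 + sqDeficit γ q) := by
  have hW := sqrt_le_one_add (sqDeficit_nonneg γ q)
  have hy : ∀ n, deficit γ q n ≤ 1 + sqDeficit γ q := fun n => (deficit_le_sqrt γ q n).trans hW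
  have hV := sqDeficit_nonneg γ q
  rw [linDrift]
  refine (Finset.abs_sum_le_sum_abs _ _).trans ?_
  refine (Finset.sum_le_sum (g := fun _ => (N + 1) * (1 + sqDeficit γ q) * (A + S))
    fun j _ => ?_).trans (le_of_eq ?_)
  · rw [abs_mul]
    have h1 : ∑ n, deficit γ q n ≤ N * (1 + sqDeficit γ q) :=
      (Finset.sum_le_sum fun n _ => hy n).trans (by simp [mul_add])
    have h2 : 0 ≤ ∑ n, deficit γ q n := Finset.sum_nonneg fun n _ => deficit_nonneg γ q n
    have h3 := mul_le_of_le_one_left h2 hγ1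
    have h4 := mul_nonneg hγ h2
    have h5 := hy j
    have h6 := deficit_nonneg γ q j
    have h7 : (routed a i j : ℝ) ≤ A := by exact_mod_cast (routed_le a i j).trans ha
    have h8 : (s j : ℝ) ≤ S := by exact_mod_cast hs j
    have h9 : (0 : ℝ) ≤ routed a i j := by positivity
    have h10 : (0 : ℝ) ≤ s j := by positivity
    refine mul_le_mul ?_ ?_ (abs_nonneg _) (by positivity)
    · rw [abs_le]; constructor <;> nlinarith
    · rw [abs_le]; constructor <;> linarith
  · simp; ring

/-! ### State-space collapse -/

/-- All odd moments of the norm of the deficit vector are bounded by powers of `1 / δ`, uniformly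
in the heavy-traffic parameter. -/
theorem exists_moment_bound [NeZero N] (M : Model N) (m : ℕ) : ∃ C : ℝ, 0 ≤ C ∧
    ∀ (P : ℝ → Policy N) (ε α γ δ : ℝ) (π : Measure (Fin N → ℕ)), ε ∈ Ioo 0 M.totalRate →
      IsProbabilityMeasure π → (transition M P ε).Invariant π →
      (∀ r : ℕ, ∫⁻ q, ‖vec q‖ₑ ^ r ∂π < ∞) → α ∈ Icc (0 : ℝ) 1 → 0 ≤ γ → γ ≤ 1 → γ * N ≤ 1 →
      γ * (1 + (N - 1) * α) = α → FavoursShorter M (P ε) α δ → ε ≤ M.totalRate / 2 →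
      ε ≤ M.totalRate * δ / 4 →
      ∫ q, sqDeficit γ q ^ m * √(sqDeficit γ q) ∂π ≤ C / δ ^ (2 * m + 1) := by
  have hN : (0 : ℝ) < N := by exact_mod_cast Nat.pos_of_ne_zero (NeZero.ne N)
  have hμ := totalRate_pos M
  set B : ℝ := (N + 1) * (M.Amax + M.Smax) with hB
  set C₁ : ℝ := N * (2 * (M.Smax : ℝ) ^ 2 + B ^ 2) with hC₁
  have hC₁0 : 0 ≤ C₁ := by positivity
  obtain ⟨K, hK, hT⟩ := pow_succ_le_taylor ((N * B) ^ 2 * (8 + 2 * B ^ 2)) (by positivity) m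
  set C₃ : ℝ := (m + 1) * C₁ + K with hC₃
  have hC₃0 : 0 ≤ C₃ := by positivity
  set c : ℝ := M.totalRate / (4 * N) with hc
  have hc0 : 0 < c := by positivity
  -- With `θ = R / δ` in `one_add_pow_le_absorb`, the lower-order terms use up at most `c / 2 * δ *
  -- x` of the drift. `R ≥ 1` together with `δ ≤ 1` ensures `θ ≥ 1`.
  set R : ℝ := max 1 (2 * (C₃ * 2 ^ m) / c) with hR
  have hR1 : 1 ≤ R := le_max_left _ _
  have hR2 : C₃ * 2 ^ m ≤ c / 2 * R := by
    have : 2 * (C₃ * 2 ^ m) / c ≤ R := le_max_right _ _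
    rw [div_le_iff₀ hc0] at this
    linarith
  refine ⟨2 / c * (C₃ * 2 ^ m * R ^ (2 * m)), by positivity, ?_⟩
  intro P ε α γ δ π hε hπ hinv hmom hα hγ0 hγ1 hγN hγ hΔ h1 h2
  have hδ0 : 0 < δ := by
    have : 0 < M.totalRate * δ := by linarith [hε.1]
    exact pos_of_mul_pos_right this hμ.le
  rcases hΔ.le_one_or hα hγ with hδ1 | hzero
  swap
  · simp only [hzero, Real.sqrt_zero, mul_zero, integral_zero]
    positivity
  set V : (Fin N → ℕ) → ℝ := sqDeficit γ with hVdef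
  have hV0 : ∀ q, 0 ≤ V q := sqDeficit_nonneg γ
  have hint : ∀ (r : ℕ), Integrable (fun q => (1 + V q) ^ r) π := by
    intro r
    refine Integrable.mono' ((integrable_one_add_tot_pow hmom (2 * r)).const_mul ((1 + N) ^ r))
      Measurable.of_discrete.aestronglyMeasurable (ae_of_all _ fun q => ?_)
    rw [Real.norm_of_nonneg (by have := hV0 q; positivity)]
    exact one_add_sqDeficit_pow_le hγ0 hγ1 q r
  have hVpow : Integrable (fun q => V q ^ (m + 1)) π := by
    refine Integrable.mono' (hint (m + 1)) Measurable.of_discrete.aestronglyMeasurable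
      (ae_of_all _ fun q => ?_)
    have := hV0 q
    rw [Real.norm_of_nonneg (by positivity)]
    gcongr
    linarith
  have hVW : Integrable (fun q => V q ^ m * √(V q)) π := by
    refine Integrable.mono' (hint (m + 1)) Measurable.of_discrete.aestronglyMeasurable
      (ae_of_all _ fun q => ?_)
    have := hV0 q
    rw [Real.norm_of_nonneg (by positivity)]
    exact sqDeficit_pow_mul_sqrt_le γ q m
  have hlin : Integrable (fun ω => V ω.1 ^ m * linDrift γ ω.1 ω.2.1 ω.2.2.1 ω.2.2.2)
      (joint M (P ε) ε π) := by
    refine integrable_joint _ hε ((hint (m + 1)).const_mul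
      (N * (N + 1) * (M.Amax + M.Smax))) fun ω ha hs => ?_
    have := hV0 ω.1
    rw [abs_mul, abs_of_nonneg (by positivity)]
    calc _ ≤ (1 + V ω.1) ^ m * (N * (N + 1) * (M.Amax + M.Smax) * (1 + V ω.1)) := by
          gcongr
          · linarith
          · exact abs_linDrift_le hγ0 hγ1 ω.1 ha hs _
      _ = _ := by ring
  have hsum : Integrable (fun ω => V ω.1 ^ (m + 1) + 2 * (m + 1) *
      (V ω.1 ^ m * linDrift γ ω.1 ω.2.1 ω.2.2.1 ω.2.2.2)) (joint M (P ε) ε π) :=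
    (integrable_fst _ hVpow).add (hlin.const_mul _)
  have key : ∫ ω, V (step ω) ^ (m + 1) ∂joint M (P ε) ε π ≤
      ∫ ω, (V ω.1 ^ (m + 1) + 2 * (m + 1) *
        (V ω.1 ^ m * linDrift γ ω.1 ω.2.1 ω.2.2.1 ω.2.2.2) +
        C₃ * (1 + V ω.1) ^ m) ∂joint M (P ε) ε π := by
    refine integral_mono_ae (integrable_step hinv hVpow)
      (hsum.add (integrable_fst _ ((hint m).const_mul C₃))) ?_
    filter_upwards [ae_joint (P ε) hε] with ω hω
    have hv := hV0 ω.1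
    have t1 := hT (V ω.1) (V (step ω)) hv (hV0 _)
      (sq_sqDeficit_next_sub_le hγ0 hγ1 hω.1 hω.2 ω.2.2.2 hB)
    have t2 : V (step ω) - V ω.1 ≤ 2 * linDrift γ ω.1 ω.2.1 ω.2.2.1 ω.2.2.2 + C₁ := by
      have := sqDeficit_next_le (q := ω.1) hγ0 hγ1 hγN hω.1 hω.2 ω.2.2.2
      have e : V (step ω) = sqDeficit γ (next ω.1 ω.2.1 ω.2.2.1 ω.2.2.2) := rfl
      rw [e]
      linarith
    have t3 := mul_le_mul_of_nonneg_left t2 (by positivity : 0 ≤ (m + 1) * V ω.1 ^ m)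
    have t4 : V ω.1 ^ m ≤ (1 + V ω.1) ^ m := by gcongr; linarith
    have t5 := mul_le_mul_of_nonneg_left t4 (by positivity : 0 ≤ (m + 1) * C₁)
    have e : C₃ * (1 + V ω.1) ^ m = (m + 1) * C₁ * (1 + V ω.1) ^ m + K * (1 + V ω.1) ^ m := by
      rw [hC₃]; ring
    rw [e]
    linarith
  rw [integral_step hinv fun q => V q ^ (m + 1),
    integral_add hsum (integrable_fst _ ((hint m).const_mul C₃)),
    integral_add (integrable_fst _ hVpow) (hlin.const_mul _),
    integral_fst (g := fun q => V q ^ (m + 1)),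
    integral_fst (g := fun q => C₃ * (1 + V q) ^ m), integral_const_mul] at key
  set x := ∫ q, V q ^ m * √(V q) ∂π with hx
  have hx0 : 0 ≤ x := integral_nonneg fun q => by have := hV0 q; positivity
  have hdrift : ∫ ω, V ω.1 ^ m * linDrift γ ω.1 ω.2.1 ω.2.2.1 ω.2.2.2 ∂joint M (P ε) ε π ≤
      -(c * δ) * x := by
    have hl := hlin
    rw [joint] at hl ⊢
    rw [Measure.integral_compProd hl, hx, ← integral_const_mul]
    refine integral_mono hl.integral_compProd (hVW.const_mul _) fun q => ?_
    simp only
    rw [integral_const_mul]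
    calc _ ≤ V q ^ m * (-(c * δ) * √(V q)) :=
          mul_le_mul_of_nonneg_left (integral_linDrift_le hε hα hγ hγN hΔ h1 h2 q)
            (by have := hV0 q; positivity)
      _ = _ := by ring
  have hlow : ∫ q, C₃ * (1 + V q) ^ m ∂π ≤
      C₃ * 2 ^ m * (x / (R / δ) + (R / δ) ^ (2 * m)) := by
    have hθ : 1 ≤ R / δ := by rw [le_div_iff₀ hδ0]; linarith
    have : ∫ q, C₃ * (1 + V q) ^ m ∂π ≤
        ∫ q, C₃ * 2 ^ m * (V q ^ m * √(V q) / (R / δ) + (R / δ) ^ (2 * m)) ∂π := by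
      refine integral_mono ((hint m).const_mul _)
        (((hVW.div_const _).add (integrable_const _)).const_mul _) fun q => ?_
      simp only
      rw [mul_assoc]
      exact mul_le_mul_of_nonneg_left (one_add_pow_le_absorb (Real.sqrt_nonneg _)
        (Real.sq_sqrt (hV0 q)).symm hθ m) hC₃0
    refine this.trans (le_of_eq ?_)
    rw [integral_const_mul, integral_add (hVW.div_const _) (integrable_const _), integral_div, hx]
    simp
  have e1 : C₃ * 2 ^ m * (x / (R / δ) + (R / δ) ^ (2 * m)) ≤
      c / 2 * δ * x + C₃ * 2 ^ m * R ^ (2 * m) / δ ^ (2 * m) := by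
    have : C₃ * 2 ^ m * (x / (R / δ)) ≤ c / 2 * δ * x := by
      have e : x / (R / δ) = x * δ / R := by field_simp
      rw [e, ← mul_div_assoc, div_le_iff₀ (by linarith)]
      have := mul_le_mul_of_nonneg_right hR2 (mul_nonneg hx0 hδ0.le)
      linarith
    rw [mul_add, div_pow, mul_div_assoc (C₃ * 2 ^ m)]
    linarith
  have e2 : c * δ * x ≤ (m + 1) * (c * δ * x) :=
    le_mul_of_one_le_left (by positivity) (by simp)
  have e3 := mul_le_mul_of_nonneg_left hdrift (by positivity : (0 : ℝ) ≤ 2 * (m + 1))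
  have e4 : c / 2 * (δ * x) ≤ C₃ * 2 ^ m * R ^ (2 * m) / δ ^ (2 * m) := by
    have : 0 ≤ c * δ * x := by positivity
    linarith
  rw [le_div_iff₀ (by positivity)] at e4 ⊢
  have e5 := mul_le_mul_of_nonneg_left e4 (by positivity : 0 ≤ 2 / c)
  refine le_trans (le_of_eq ?_) e5
  field_simp
  ring

/-! ### The cross term between total queue length and unused service -/

/-- Explicit upper bound on the scaled mean total queue length. -/
theorem exists_tot_bound [NeZero N] (M : Model N) (m : ℕ) : ∃ C : ℝ, 0 ≤ C ∧
    ∀ (P : ℝ → Policy N) (ε α δ s : ℝ) (π : Measure (Fin N → ℕ)), ε ∈ Ioo 0 M.totalRate →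
      IsProbabilityMeasure π → (transition M P ε).Invariant π →
      (∀ r : ℕ, ∫⁻ q, ‖vec q‖ₑ ^ r ∂π < ∞) → α ∈ Icc (0 : ℝ) 1 → 0 < α * δ →
      FavoursShorter M (P ε) α δ → ε ≤ M.totalRate / 2 → ε ≤ M.totalRate * δ / 4 → 0 < s →
      ε * ∫ q, tot q ∂π ≤ (var (M.arr ε) + M.totalSvcVar + ε ^ 2) / 2 +
        N / (α * δ) * (s * ε + C / s ^ (2 * m)) := by
  obtain ⟨C, hC0, hC⟩ := exists_moment_bound M m
  refine ⟨N * M.Smax * C, by positivity, ?_⟩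
  intro P ε α δ s π hε hπ hinv hmom hα hαδ hΔ h1 h2 hs
  have h1N : (1 : ℝ) ≤ N := by exact_mod_cast Nat.one_le_iff_ne_zero.2 (NeZero.ne N)
  have hα0 : 0 < α := by
    rcases hα.1.eq_or_lt with h | h
    · rw [← h] at hαδ; simp at hαδ
    · exact h
  have hδ0 : 0 < δ := pos_of_mul_pos_right hαδ hα0.le
  have hden : 1 ≤ 1 + (N - 1) * α := by nlinarith
  have hden0 : 0 < 1 + (N - 1) * α := by linarith
  set γ := α / (1 + (N - 1) * α) with hγdef
  have hγpos : 0 < γ := by positivity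
  have hγN : γ * N ≤ 1 := by
    rw [hγdef, div_mul_eq_mul_div, div_le_one hden0]; nlinarith [hα.2]
  have hγ1 : γ ≤ 1 := by nlinarith
  have hγ : γ * (1 + (N - 1) * α) = α := div_mul_cancel₀ _ hden0.ne'
  -- Dividing by `γ` thus costs at most a factor `N / α`.
  have hγα : α ≤ N * γ := by
    rw [← hγ, mul_comm]
    exact mul_le_mul_of_nonneg_right (by nlinarith [hα.2]) hγpos.le
  have hm := hC P ε α γ δ π hε hπ hinv hmom hα hγpos.le hγ1 hγN hγ hΔ h1 h2
  have hmain := two_mul_integral_tot_le hε hinv hmom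
  -- The moment bound places `√V` on the scale `1 / δ`. Below the level `t` the mean waste `ε` is
  -- used; above it, `V ^ m / t ^ (2 * m) ≥ 1` brings in the moment bound.
  set t := s / δ with ht
  have ht0 : 0 < t := by positivity
  have hVW : Integrable (fun q => sqDeficit γ q ^ m * √(sqDeficit γ q)) π := by
    refine Integrable.mono' ((integrable_one_add_tot_pow hmom (2 * (m + 1))).const_mul
      ((1 + N) ^ (m + 1))) Measurable.of_discrete.aestronglyMeasurable (ae_of_all _ fun q => ?_)
    have := sqDeficit_nonneg γ q
    rw [Real.norm_of_nonneg (by positivity)]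
    exact (sqDeficit_pow_mul_sqrt_le γ q m).trans (one_add_sqDeficit_pow_le hγpos.le hγ1 q _)
  have hcross : γ * ∫ ω, tot (step ω) * waste ω ∂joint M (P ε) ε π ≤
      t * ε + N * M.Smax / t ^ (2 * m) * (C / δ ^ (2 * m + 1)) := by
    have hi := integrable_waste (π := π) (P ε) hε
    have hstep := integrable_step hinv hVW
    have : ∫ ω, γ * (tot (step ω) * waste ω) ∂joint M (P ε) ε π ≤
        ∫ ω, (t * waste ω + N * M.Smax / t ^ (2 * m) *
          (sqDeficit γ (step ω) ^ m * √(sqDeficit γ (step ω)))) ∂joint M (P ε) ε π := by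
      refine integral_mono_of_nonneg (ae_of_all _ fun ω => mul_nonneg hγpos.le
        (mul_nonneg (tot_nonneg _) (waste_nonneg _)))
        ((hi.const_mul t).add (hstep.const_mul _)) ?_
      filter_upwards [ae_joint (P ε) hε] with ω hω
      refine (tot_next_mul_unused_le ω.1 ω.2.1 ω.2.2.1 ω.2.2.2).trans ?_
      have e : ∑ j, (unused ω.1 ω.2.1 ω.2.2.1 ω.2.2.2 j : ℝ) = waste ω := rfl
      have e' : next ω.1 ω.2.1 ω.2.2.1 ω.2.2.2 = step ω := rfl
      rw [e, e']
      set v := sqDeficit γ (step ω)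
      have hv : 0 ≤ v := sqDeficit_nonneg γ _
      have hw := waste_nonneg ω
      have hw' := waste_le hω.2
      rcases le_total (√v) t with h | h
      · have := mul_le_mul_of_nonneg_right h hw
        have : 0 ≤ N * M.Smax / t ^ (2 * m) * (v ^ m * √v) := by positivity
        linarith
      · have a1 : t ^ (2 * m) ≤ v ^ m := by
          rw [pow_mul]
          refine pow_le_pow_left₀ (by positivity) ?_ m
          rw [← Real.sq_sqrt hv]
          exact pow_le_pow_left₀ ht0.le h 2
        have a2 : 1 ≤ v ^ m / t ^ (2 * m) := by rwa [one_le_div (by positivity)]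
        calc √v * waste ω ≤ √v * (N * M.Smax) := by gcongr
          _ ≤ √v * (N * M.Smax) * (v ^ m / t ^ (2 * m)) :=
              le_mul_of_one_le_right (by positivity) a2
          _ = N * M.Smax / t ^ (2 * m) * (v ^ m * √v) := by ring
          _ ≤ _ := le_add_of_nonneg_left (mul_nonneg ht0.le hw)
    rw [integral_const_mul, integral_add (hi.const_mul t) (hstep.const_mul _), integral_const_mul,
      integral_const_mul, integral_waste hε hinv hmom,
      integral_step hinv fun q => sqDeficit γ q ^ m * √(sqDeficit γ q)] at this
    refine this.trans ?_
    gcongr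
  have e1 : t * ε + N * M.Smax / t ^ (2 * m) * (C / δ ^ (2 * m + 1)) =
      (s * ε + N * M.Smax * C / s ^ (2 * m)) / δ := by
    rw [ht, div_pow]
    field_simp
    ring
  rw [e1] at hcross
  set Z := ∫ ω, tot (step ω) * waste ω ∂joint M (P ε) ε π
  have hZ0 : 0 ≤ Z := integral_nonneg fun ω => mul_nonneg (tot_nonneg _) (waste_nonneg _)
  have hZ : Z ≤ N / (α * δ) * (s * ε + N * M.Smax * C / s ^ (2 * m)) := by
    rw [div_mul_eq_mul_div, le_div_iff₀ hαδ]
    rw [le_div_iff₀ hδ0] at hcross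
    have a1 := mul_le_mul_of_nonneg_right hγα (mul_nonneg hZ0 hδ0.le)
    have a2 := mul_le_mul_of_nonneg_left hcross (by positivity : (0 : ℝ) ≤ N)
    linarith
  linarith

/-! ### The heavy-traffic limit -/

theorem tendsto_rpow_zero {a : ℝ} (ha : 0 < a) :
    Tendsto (fun ε : ℝ => ε ^ a) (𝓝[>] 0) (𝓝 0) := by
  have := (Real.continuousAt_rpow_const 0 a (Or.inr ha.le)).tendsto
  rw [Real.zero_rpow ha.ne'] at this
  exact this.mono_left nhdsWithin_le_nhds

end LoadBalancing

theorem proposition3 {N : ℕ} [NeZero N] (M : LoadBalancing.Model N)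
    (P : ℝ → LoadBalancing.Policy N) (σ2 : ℝ)
    (hσ : Tendsto (fun ε => LoadBalancing.var (M.arr ε)) (𝓝[>] 0) (𝓝 σ2))
    (hP : LoadBalancing.ThroughputOptimal M P)
    (α δ : ℝ → ℝ) (β : ℝ) (hβ : β ∈ Ico (0 : ℝ) 1)
    (hα : ∀ ε ∈ Ioo 0 M.totalRate, α ε ∈ Icc (0 : ℝ) 1)
    (hΔ : ∀ ε ∈ Ioo 0 M.totalRate, LoadBalancing.FavoursShorter M (P ε) (α ε) (δ ε))
    (hΩ : ∃ c > 0, ∀ᶠ ε in 𝓝[>] (0 : ℝ), c * ε ^ β ≤ α ε * δ ε) :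
    LoadBalancing.HeavyTrafficDelayOptimal M P σ2 := by
  intro π hπ
  obtain ⟨c, hc, hΩ⟩ := hΩ
  have hμ := LoadBalancing.totalRate_pos M
  have hβ1 : 0 < 1 - β := sub_pos.2 hβ.2
  -- This makes the exponent `m * (1 - β) - β` positive.
  obtain ⟨m, hm⟩ := exists_nat_gt (β / (1 - β))
  rw [div_lt_iff₀ hβ1] at hm
  obtain ⟨C, hC0, hC⟩ := LoadBalancing.exists_tot_bound M m
  set h : ℝ → ℝ := fun ε => (LoadBalancing.var (M.arr ε) + M.totalSvcVar + ε ^ 2) / 2 +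
    N / c * (ε ^ ((1 - β) / 2) + C * ε ^ (m * (1 - β) - β)) with hh
  have hlim : Tendsto h (𝓝[>] 0) (𝓝 ((σ2 + M.totalSvcVar) / 2)) := by
    have t1 : Tendsto (fun ε : ℝ => ε ^ 2) (𝓝[>] 0) (𝓝 0) := by
      have := (continuous_pow 2 (M := ℝ)).tendsto 0
      simp only [ne_eq, OfNat.ofNat_ne_zero, not_false_eq_true, zero_pow] at this
      exact this.mono_left nhdsWithin_le_nhds
    have t2 := LoadBalancing.tendsto_rpow_zero (a := (1 - β) / 2) (by linarith)
    have t3 := LoadBalancing.tendsto_rpow_zero (a := m * (1 - β) - β) (by linarith)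
    have := (((hσ.add_const M.totalSvcVar).add t1).div_const 2).add
      ((t2.add (t3.const_mul C)).const_mul (N / c))
    simpa using this
  refine le_trans (limsup_le_limsup ?_) (ENNReal.tendsto_ofReal hlim).limsup_eq.le
  have hpos : ∀ᶠ ε : ℝ in 𝓝[>] 0, 0 < ε := self_mem_nhdsWithin
  have hlt : ∀ᶠ ε : ℝ in 𝓝[>] 0, ε < M.totalRate / 2 :=
    mem_nhdsWithin_of_mem_nhds (Iio_mem_nhds (by positivity))
  have hsmall : ∀ᶠ ε : ℝ in 𝓝[>] 0, ε ^ (1 - β) < M.totalRate * c / 4 :=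
    (LoadBalancing.tendsto_rpow_zero hβ1).eventually_lt_const (by positivity)
  filter_upwards [hΩ, hpos, hlt, hsmall] with ε h1 h2 h3 h4
  have hε : ε ∈ Ioo 0 M.totalRate := ⟨h2, by linarith⟩
  obtain ⟨hprob, hinv⟩ := hπ ε hε
  have hmom := (hP ε hε).2 (π ε) ⟨hprob, hinv⟩
  have hεβ : 0 < ε ^ β := Real.rpow_pos_of_pos h2 β
  have hαδ : 0 < α ε * δ ε := lt_of_lt_of_le (by positivity) h1
  have hα0 : 0 < α ε := by
    rcases (hα ε hε).1.eq_or_lt with h | h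
    · rw [← h] at hαδ; simp at hαδ
    · exact h
  have hδ0 : 0 < δ ε := pos_of_mul_pos_right hαδ hα0.le
  have hδ : c * ε ^ β ≤ δ ε := h1.trans (mul_le_of_le_one_left hδ0.le (hα ε hε).2)
  have e1 : ε ^ (1 - β) * ε ^ β = ε := by
    rw [← Real.rpow_add h2]; simp
  have h5 : ε ≤ M.totalRate * δ ε / 4 := by
    calc ε = ε ^ (1 - β) * ε ^ β := e1.symm
      _ ≤ M.totalRate * c / 4 * ε ^ β := by gcongr
      _ = M.totalRate * (c * ε ^ β) / 4 := by ring
      _ ≤ _ := by gcongr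
  -- Taking `s = ε ^ (-(1 - β) / 2)`, division by `ε ^ β` turns `s * ε` into `ε ^ ((1 - β) / 2)` and
  -- `s ^ (-2 m)` into `ε ^ (m * (1 - β) - β)`; both tend to zero.
  have key := hC P ε (α ε) (δ ε) (ε ^ (-((1 - β) / 2))) (π ε) hε hprob hinv hmom (hα ε hε) hαδ
    (hΔ ε hε) h3.le h5 (Real.rpow_pos_of_pos h2 _)
  have e2 : N / (α ε * δ ε) * (ε ^ (-((1 - β) / 2)) * ε + C / (ε ^ (-((1 - β) / 2))) ^ (2 * m)) ≤
      N / c * (ε ^ ((1 - β) / 2) + C * ε ^ (m * (1 - β) - β)) := by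
    have a0 : (ε ^ (-((1 - β) / 2))) ^ (2 * m) = ε ^ (-(m * (1 - β))) := by
      rw [← Real.rpow_natCast, ← Real.rpow_mul h2.le]
      congr 1
      push_cast
      ring
    have a1 : ε ^ (-((1 - β) / 2)) * ε = ε ^ ((1 - β) / 2) * ε ^ β := by
      rw [← Real.rpow_add h2, ← Real.rpow_add_one h2.ne']
      congr 1
      ring
    have a2 : C / ε ^ (-(m * (1 - β))) = C * ε ^ (m * (1 - β) - β) * ε ^ β := by
      rw [mul_assoc, ← Real.rpow_add h2, Real.rpow_neg h2.le, div_inv_eq_mul]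
      congr 2
      ring
    rw [a0, a1, a2, ← add_mul]
    have hX : 0 ≤ ε ^ ((1 - β) / 2) + C * ε ^ (m * (1 - β) - β) := by positivity
    rw [div_mul_eq_mul_div, div_mul_eq_mul_div, div_le_div_iff₀ hαδ hc]
    have := mul_le_mul_of_nonneg_left h1 (mul_nonneg (Nat.cast_nonneg (α := ℝ) N) hX)
    linarith
  have e3 : ∫⁻ q, (∑ n, (q n : ℝ≥0∞)) ∂(π ε) =
      ENNReal.ofReal (∫ q, LoadBalancing.tot q ∂(π ε)) := by
    rw [ofReal_integral_eq_lintegral_ofReal (LoadBalancing.integrable_tot hmom)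
      (ae_of_all _ LoadBalancing.tot_nonneg)]
    refine lintegral_congr fun q => ?_
    rw [LoadBalancing.tot, ENNReal.ofReal_sum_of_nonneg fun _ _ => by positivity]
    simp
  rw [e3, ← ENNReal.ofReal_mul h2.le]
  exact ENNReal.ofReal_le_ofReal (key.trans (by simp only [hh]; linarith))
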